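/- Let $E$ be a countable (finite or countably infinite) set and let $(M_i : i\in\Theta)$ be a family of matroids on $E$, where $\Theta$ is an arbitrary index set. (Matroids may be infinite: $M=(E,\mathcal I)$ is a matroid if $\mathcal I\subseteq\mathcal P(E)$ contains $\varnothing$, is closed under taking subsets, for every non-maximal $I\in\mathcal I$ and every maximal $J\in\mathcal I$ there is an $e\in J\setminus I$ with $I\cup\{e\}\in\mathcal I$, and for every $X\subseteq E$ each $I\in\mathcal I\cap\mathcal P(X)$ extends to a maximal element of $\mathcal I\cap\mathcal P(X)$.) A matroid is finitary if every set all of whose finite subsets are independent is itself independent, and cofinitary if its dual $M^*$ (the matroid on $E$ whose bases are the complements of the bases of $M$) is finitary. Assume that each $M_i$ is the direct sum of a finitary matroid and a cofinitary matroid (i.e. $M_i\in\mathfrak F\oplus\mathfrak F^*$). Then there is a partition $E=E_p\sqcup E_c$ (parts may be empty) such that 1. $(M_i\restriction E_p : i\in\Theta)$ admits a packing: there are pairwise disjoint sets $S_i\subseteq E_p$ $(i\in\Theta)$ such that $S_i$ is spanning in the restriction $M_i\restriction E_p$ for every $i\in\Theta$; and 2. $(M_i.E_c : i\in\Theta)$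 admits a covering: there are sets $I_i\subseteq E_c$ $(i\in\Theta)$ with $\bigcup_{i\in\Theta}I_i=E_c$ such that $I_i$ is independent in $M_i.E_c$ for every $i\in\Theta$, where $M_i.E_c:=M_i/(E\setminus E_c)=(M_i^*\restriction E_c)^*$ is the contraction of $M_i$ onto $E_c$. -/

import Mathlib

namespace Matroid

/-- `M` is cofinitary if its dual is finitary, i.e. all its cocircuits are finite. -/
def IsCofinitary {α : Type*} (M : Matroid α) : Prop := M✶.Finitary

/-- The class `𝔉 ⊕ 𝔉*`: `M` is the direct sum of a finitary matroid and a cofinitary matroid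
(on disjoint, possibly empty, ground sets whose union is the ground set of `M`). -/
def IsFinitarySumCofinitary {α : Type*} (M : Matroid α) : Prop :=
  ∃ (F C : Matroid α) (h : Disjoint F.E C.E),
    F.Finitary ∧ C.IsCofinitary ∧ M = F.disjointSum C h

/-- The contraction of `M` onto `X`, i.e. the minor `M.X := M / (E(M) \ X)`. -/
def contractOnto {α : Type*} (M : Matroid α) (X : Set α) : Matroid α :=
  M.contract (M.E \ X)

/-- `S` is a packing for the family `M`: the sets `S i` are pairwise disjoint and `S i` is a
spanning subset of the ground set of `M i`. -/
def IsPacking {α Θ : Type*} (M : Θ → Matroid α) (S : Θ → Set α) : Prop :=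
  (∀ i j, i ≠ j → Disjoint (S i) (S j)) ∧ ∀ i, (M i).Spanning (S i)

/-- `I` is a covering for the family `M` of matroids on the common ground set `E`: the union of
the sets `I i` is `E`, and `I i` is independent in `M i`. -/
def IsCovering {α Θ : Type*} (E : Set α) (M : Θ → Matroid α) (I : Θ → Set α) : Prop :=
  (⋃ i, I i) = E ∧ ∀ i, (M i).Indep (I i)

end Matroid

/-! Packing/covering is reduced to an intersection theorem for two finitary matroids on a countable
set: some common independent set `B` and some `P` satisfy that `B ∩ P` spans `P` in `M` and `B \ P`
spans the complement in `N` (`exists_indep_indep_subset_closure`).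

For the intersection theorem, a maximal wave is split off, leaving a loose pair, in which an
`M`-independent, `N`-spanning set is needed. The tool is a finite sequence of exchanges. The
elements it cannot make `M`-unspanned form a set that is self-contained for both matroids, hence a
candidate wave; looseness therefore forces exchanges to succeed. First, any `u` can be absorbed into
a feasible pair: contract `u` and take a maximal wave of what remains
(`Loose.exists_isFeasible_mem`). Absorbing everything yields an `M`-base, which need not span in
`N`. Second, augmenting this base lets it span any finite set in `N`, because permanent failures
would make up a wave (`Loose.exists_augs`). Only finitely many elements change, so cutting back to a
late stage gives a feasible pair again (`Loose.exists_isFeasible_closure`). Since `N` is finitary,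
doing this for each element in turn suffices (`Loose.exists_indep_spanning`).

For the reduction, the finitary summands enter one sum matroid directly and the cofinitary ones
enter the other through their finitary duals; a uniform summand makes the selected sets disjoint.
Uncountable index sets are handled at the end: elements that are nonloops of uncountably many
matroids can be covered by singletons. -/

namespace Matroid

open Set

/-! ### Exchange sequences and the set they reach. -/

section Swap

variable {β : Type*} {M N : Matroid β} {J J' J₀ : Set β} {r v x : β}

/-- `J'` arises from `J` by exchanging a single element, where the new element is not spanned
by `J` in `M`, and the closure in `N` does not change. -/
def SwapStep (M N : Matroid β) (J J' : Set β) : Prop :=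
  ∃ w h, w ∈ M.E ∧ w ∉ M.closure J ∧ w ∈ N.closure J ∧ h ∈ J ∧ J' = insert w J \ {h} ∧
    N.closure J' = N.closure J

/-- `J'` arises from `J` by finitely many swap steps. -/
def Swaps (M N : Matroid β) : Set β → Set β → Prop := Relation.ReflTransGen (SwapStep M N)

/-- The elements that are not spanned in `M` by some set arising from `J₀` by swaps. -/
def swapReach (M N : Matroid β) (J₀ : Set β) : Set β :=
  {r | r ∈ M.E ∧ ∃ J, Swaps M N J₀ J ∧ r ∉ M.closure J}

lemma SwapStep.indep (h : SwapStep M N J J') (hJ : M.Indep J) : M.Indep J' := by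
  obtain ⟨w, h, hwE, hw, -, -, rfl, -⟩ := h
  exact (hJ.insert_indep_iff.2 (.inl ⟨hwE, hw⟩)).subset sdiff_subset

lemma Swaps.indep (h : Swaps M N J J') (hJ : M.Indep J) : M.Indep J' := by
  induction h with
  | refl => exact hJ
  | tail _ h ih => exact h.indep ih

lemma Swaps.closure_eq (h : Swaps M N J J') : N.closure J' = N.closure J := by
  induction h with
  | refl => rfl
  | tail _ h ih =>
    obtain ⟨_, _, -, -, -, -, -, hcl⟩ := h
    exact hcl.trans ih

lemma SwapStep.indep_right (h : SwapStep M N J J') (hJ : N.Indep J) : N.Indep J' := by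
  obtain ⟨w, h, -, -, hwN, hh, rfl, hcl⟩ := h
  obtain rfl | hne := eq_or_ne w h
  · exact hJ.subset (by simp [sdiff_subset_iff, subset_insert])
  rw [insert_sdiff_of_notMem _ (by simpa using hne)] at hcl ⊢
  refine (hJ.subset sdiff_subset).insert_indep_iff.2
    (.inl ⟨N.closure_subset_ground _ hwN, fun hcon ↦ ?_⟩)
  rw [closure_insert_eq_of_mem_closure hcon] at hcl
  exact hJ.notMem_closure_sdiff_of_mem hh
    (hcl ▸ N.mem_closure_of_mem' hh (hJ.subset_ground hh))

lemma Swaps.indep_right (h : Swaps M N J J') (hJ : N.Indep J) : N.Indep J' := by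
  induction h with
  | refl => exact hJ
  | tail _ h ih => exact h.indep_right ih

/-- A swap moves the hole of a set that is one element short of spanning `M`: putting `h` back
restores `insert w J`, which spans, and by exchange so does any other unspanned element. -/
lemma SwapStep.closure_insert_eq_ground (h : SwapStep M N J J')
    (hx : M.closure (insert x J) = M.E) (hr : r ∈ M.E) (hrJ : r ∉ M.closure J') :
    M.closure (insert r J') = M.E := by
  obtain ⟨w, h, hwE, hw, -, hh, rfl, -⟩ := h
  have hwJ : M.closure (insert w J) = M.E := by
    rw [← hx]
    refine closure_insert_congr ⟨?_, hw⟩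
    rwa [hx]
  have hwJh : M.closure (insert h (insert w J \ {h})) = M.E := by
    rw [insert_sdiff_singleton, insert_eq_of_mem (mem_insert_of_mem _ hh), hwJ]
  rw [← hwJh]
  refine closure_insert_congr ⟨?_, hrJ⟩
  rwa [hwJh]

lemma Swaps.closure_insert_eq_ground (h : Swaps M N J J')
    (hx : M.closure (insert x J) = M.E) (hr : r ∈ M.E) (hrJ : r ∉ M.closure J') :
    M.closure (insert r J') = M.E := by
  induction h generalizing r with
  | refl =>
    rw [← hx]
    exact closure_insert_congr ⟨by rwa [hx], hrJ⟩
  | @tail K K' hJK h ih =>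
    have hh := h
    obtain ⟨w, -, hwE, hw, -⟩ := hh
    exact h.closure_insert_eq_ground (ih hwE hw) hr hrJ

lemma Swaps.finite_sdiff (h : Swaps M N J J') : (J' \ J).Finite ∧ (J \ J').Finite := by
  induction h with
  | refl => simp
  | @tail K K' _ h ih =>
    obtain ⟨w, h, -, -, -, hh, rfl, -⟩ := h
    refine ⟨(ih.1.insert w).subset fun a ha ↦ ?_, (ih.2.insert h).subset fun a ha ↦ ?_⟩
    · simp only [mem_sdiff, mem_insert_iff, mem_singleton_iff] at ha ⊢
      tauto
    · simp only [mem_sdiff, mem_insert_iff, mem_singleton_iff] at ha ⊢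
      tauto

/-- Exchanging along an `N`-circuit preserves the `N`-closure, and the discarded element becomes the
new hole in `M`. Thus reachability spreads from `r` over its whole circuit. -/
lemma Swaps.exists_swapStep_of_isCircuit (hE : M.E = N.E) (hJ : M.Indep J) (hrE : r ∈ M.E)
    (hr : r ∉ M.closure J) {C : Set β} (hCJ : C ⊆ insert r J) (hC : N.IsCircuit C) (hrC : r ∈ C)
    {h : β} (hh : h ∈ C \ {r}) : SwapStep M N J (insert r J \ {h}) ∧
      h ∉ M.closure (insert r J \ {h}) := by
  have hJN : J ⊆ N.E := hE ▸ hJ.subset_ground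
  have hhJ : h ∈ J := by
    obtain rfl | h' := hCJ hh.1
    · exact (hh.2 rfl).elim
    exact h'
  have hrJ : r ∈ N.closure J :=
    N.closure_subset_closure (by simpa [sdiff_subset_iff] using hCJ)
      (hC.mem_closure_sdiff_singleton_of_mem hrC)
  have hins : M.Indep (insert r J) := hJ.insert_indep_iff.2 (.inl ⟨hrE, hr⟩)
  refine ⟨⟨r, h, hrE, hr, hrJ, hhJ, rfl, ?_⟩, hins.notMem_closure_sdiff_of_mem (.inr hhJ)⟩
  rw [closure_sdiff_singleton_eq_closure, closure_insert_eq_of_mem_closure hrJ]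
  exact N.closure_subset_closure (sdiff_subset_sdiff_left hCJ)
    (hC.mem_closure_sdiff_singleton_of_mem hh.1)

lemma Swaps.mem_closure_inter_swapReach (hE : M.E = N.E) (hJ₀ : M.Indep J₀)
    (hs : Swaps M N J₀ J) (hrE : r ∈ M.E) (hr : r ∉ M.closure J) (hrJ : r ∈ N.closure J) :
    r ∈ N.closure (J ∩ swapReach M N J₀) := by
  have hJ := hs.indep hJ₀
  have hrJ' : r ∉ J := fun h ↦ hr (M.mem_closure_of_mem h hJ.subset_ground)
  obtain ⟨C, hCJ, hC, hrC⟩ := (mem_closure_iff_exists_isCircuit hrJ').1 hrJ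
  refine N.closure_subset_closure (fun h hh ↦ ?_) (hC.mem_closure_sdiff_singleton_of_mem hrC)
  have hhJ : h ∈ J := by
    obtain rfl | h' := hCJ hh.1
    · exact (hh.2 rfl).elim
    exact h'
  obtain ⟨h1, h2⟩ := Swaps.exists_swapStep_of_isCircuit hE hJ hrE hr hCJ hC hrC hh
  exact ⟨hhJ, hJ.subset_ground hhJ, _, hs.tail h1, h2⟩

lemma Swaps.inter_swapReach_subset_closure (hE : M.E = N.E) (hJ₀ : M.Indep J₀)
    (hs : Swaps M N J₀ J) :
    J ∩ swapReach M N J₀ ⊆ N.closure (J₀ ∩ swapReach M N J₀) := by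
  induction hs with
  | refl => exact N.subset_closure _ (inter_subset_left.trans (hE ▸ hJ₀.subset_ground))
  | @tail K K' hs h ih =>
    obtain ⟨w, h, hwE, hw, hwN, hh, rfl, hcl⟩ := h
    rintro a ⟨⟨rfl | ha, hah⟩, haR⟩
    · exact closure_subset_closure_of_subset_closure ih
        (Swaps.mem_closure_inter_swapReach hE hJ₀ hs hwE hw hwN)
    · exact ih ⟨ha, haR⟩

/-- The reachable elements which are spanned in `N` are spanned by reachable elements. -/
lemma swapReach_inter_closure_subset (hE : M.E = N.E) (hJ₀ : M.Indep J₀) :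
    swapReach M N J₀ ∩ N.closure J₀ ⊆ N.closure (J₀ ∩ swapReach M N J₀) := by
  rintro r ⟨⟨hrE, J, hs, hr⟩, hrN⟩
  exact closure_subset_closure_of_subset_closure (hs.inter_swapReach_subset_closure hE hJ₀)
    (Swaps.mem_closure_inter_swapReach hE hJ₀ hs hrE hr (hs.closure_eq.symm ▸ hrN))

/-- Both elements involved in a swap are reachable, so swaps never touch anything outside the reach.
-/
lemma Swaps.sdiff_swapReach (hJ₀ : M.Indep J₀) (hs : Swaps M N J₀ J) :
    J \ swapReach M N J₀ = J₀ \ swapReach M N J₀ := by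
  induction hs with
  | refl => rfl
  | @tail K K' hs hst ih =>
    have hK := Swaps.indep hs hJ₀
    have hst' := hst
    obtain ⟨w, h, hwE, hw, hwN, hh, rfl, hcl⟩ := hst
    rw [← ih]
    have hwR : w ∈ swapReach M N J₀ := ⟨hwE, _, hs, hw⟩
    have hins : M.Indep (insert w K) := hK.insert_indep_iff.2 (.inl ⟨hwE, hw⟩)
    have hhR : h ∈ swapReach M N J₀ := ⟨hK.subset_ground hh, _, hs.tail hst',
      hins.notMem_closure_sdiff_of_mem (.inr hh)⟩
    ext a
    simp only [mem_sdiff, mem_insert_iff, mem_singleton_iff]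
    constructor
    · rintro ⟨⟨rfl | h1, h2⟩, h3⟩ <;> tauto
    · rintro ⟨h1, h2⟩
      refine ⟨⟨.inr h1, ?_⟩, h2⟩
      rintro rfl
      exact h2 hhR

/-- Unreachable elements are spanned in `M` by unreachable elements. -/
lemma sdiff_swapReach_subset_closure (hJ₀ : M.Indep J₀) :
    M.E \ swapReach M N J₀ ⊆ M.closure (J₀ \ swapReach M N J₀) := by
  rintro v ⟨hvE, hv⟩
  have hv' : ∀ J, Swaps M N J₀ J → v ∈ M.closure J := by
    intro J hs
    by_contra hcon
    exact hv ⟨hvE, J, hs, hcon⟩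
  by_cases hvJ : v ∈ J₀
  · exact M.mem_closure_of_mem' ⟨hvJ, hv⟩ hvE
  obtain ⟨C, hCJ, hC, hvC⟩ := (mem_closure_iff_exists_isCircuit hvJ).1 (hv' _ .refl)
  have hvcl := hC.mem_closure_sdiff_singleton_of_mem hvC
  -- No swap can discard an element `a` of the circuit: `v` would stay spanned only thanks to the
  -- new element `w`, and exchange would then put `w` into the `M`-closure of the old set.
  have key : ∀ J, Swaps M N J₀ J → C \ {v} ⊆ J := by
    intro J hs
    induction hs with
    | refl => simpa [sdiff_subset_iff] using hCJ
    | @tail K K' hs hst ih =>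
      have hK := Swaps.indep hs hJ₀
      have hst' := hst
      obtain ⟨w, h, hwE, hw, hwN, hh, rfl, hcl⟩ := hst
      refine fun a ha ↦ ⟨.inr (ih ha), ?_⟩
      rintro rfl
      have h1 := hv' _ (hs.tail hst')
      have hwa : w ≠ a := fun h ↦ hw (h ▸ M.mem_closure_of_mem hh hK.subset_ground)
      rw [insert_sdiff_of_notMem _ (by simpa using hwa)] at h1
      have h2 : v ∉ M.closure (K \ {a}) := by
        intro hcon
        refine hK.notMem_closure_sdiff_of_mem hh ?_
        refine closure_subset_closure_of_subset_closure (X := C \ {a}) ?_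
          (hC.mem_closure_sdiff_singleton_of_mem ha.1)
        intro b hb
        obtain rfl | hbv := eq_or_ne b v
        · exact hcon
        exact M.mem_closure_of_mem (X := K \ {a}) ⟨ih ⟨hb.1, hbv⟩, hb.2⟩
          (sdiff_subset.trans hK.subset_ground)
      have h3 := mem_closure_insert h2 h1
      refine hw (closure_subset_closure_of_subset_closure ?_ h3)
      exact insert_subset (hv' _ hs) (sdiff_subset.trans (M.subset_closure _ hK.subset_ground))
  suffices hsub : C \ {v} ⊆ J₀ \ swapReach M N J₀ from M.closure_subset_closure hsub hvcl
  refine fun a ha ↦ ⟨key _ .refl ha, ?_⟩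
  rintro ⟨haE, J, hs, haJ⟩
  exact haJ (M.mem_closure_of_mem (key _ hs ha) (hs.indep hJ₀).subset_ground)

end Swap

/-! ### Waves, loose pairs and feasible pairs. -/

section Wave

variable {β : Type*} {M N : Matroid β} {W W' S S' Q I Q' I' : Set β} {u : β}

/-- A set `W`, together with a subset `S` that spans `W` in `M` and is independent in the
contraction of `N` onto `W`. -/
structure IsWave (M N : Matroid β) (W S : Set β) : Prop where
  subset : S ⊆ W
  subset_ground : W ⊆ M.E
  subset_closure : W ⊆ M.closure S
  notMem_closure : ∀ s ∈ S, s ∉ N.closure (S \ {s} ∪ (N.E \ W))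

/-- The pair `(M, N)` is loose if it has no nonempty wave. -/
def Loose (M N : Matroid β) : Prop := ∀ W S, IsWave M N W S → W = ∅

/-- A set `I` which spans `Q` in `M`, such that contracting `I` and removing the remaining
elements of `Q` leaves a loose pair in which `Q` can still be spanned in `N`. -/
structure IsFeasible (M N : Matroid β) (Q I : Set β) : Prop where
  subset : I ⊆ Q
  subset_ground : Q ⊆ M.E
  indep : M.Indep I
  subset_closure : Q ⊆ M.closure I
  subset_closure_right : Q ⊆ N.closure (I ∪ (N.E \ Q))
  loose : Loose (M ／ Q) (N ／ I ＼ Q)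

lemma closure_contract_delete_eq (N : Matroid β) (hIQ : I ⊆ Q) {X : Set β} (hX : Disjoint X Q) :
    (N ／ I ＼ Q).closure X = N.closure (I ∪ X) \ Q := by
  rw [delete_closure_eq, contract_closure_eq, hX.sdiff_eq_left, sdiff_sdiff,
    union_eq_self_of_subset_left hIQ, union_comm]

lemma ground_contract_delete_eq (N : Matroid β) (hIQ : I ⊆ Q) :
    (N ／ I ＼ Q).E = N.E \ Q := by
  rw [delete_ground, contract_ground, sdiff_sdiff, union_eq_self_of_subset_left hIQ]

lemma isWave_minor_iff (hIQ : I ⊆ Q) :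
    IsWave (M ／ Q) (N ／ I ＼ Q) W S ↔ S ⊆ W ∧ W ⊆ M.E \ Q ∧ W ⊆ M.closure (Q ∪ S) ∧
      ∀ s ∈ S, s ∉ N.closure (I ∪ (S \ {s}) ∪ (N.E \ (Q ∪ W))) := by
  have aux (hSW : S ⊆ W) (hW : W ⊆ M.E \ Q) (s : β) :
      (N ／ I ＼ Q).closure (S \ {s} ∪ ((N ／ I ＼ Q).E \ W)) =
        N.closure (I ∪ (S \ {s}) ∪ (N.E \ (Q ∪ W))) \ Q := by
    rw [closure_contract_delete_eq N hIQ, ground_contract_delete_eq N hIQ, sdiff_sdiff, union_assoc]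
    rw [ground_contract_delete_eq N hIQ]
    refine disjoint_union_left.2 ⟨?_, ?_⟩
    · exact (subset_sdiff.1 (hSW.trans hW)).2.mono_left sdiff_subset
    · exact disjoint_sdiff_left.mono_left sdiff_subset
  constructor
  · rintro ⟨h1, h2, h3, h4⟩
    refine ⟨h1, h2, ?_, fun s hs hcon ↦ h4 s hs ?_⟩
    · rw [contract_closure_eq, union_comm] at h3
      exact h3.trans sdiff_subset
    · rw [aux h1 h2]
      exact ⟨hcon, (h2 (h1 hs)).2⟩
  · rintro ⟨h1, h2, h3, h4⟩
    refine ⟨h1, h2, ?_, fun s hs hcon ↦ h4 s hs ?_⟩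
    · rw [contract_closure_eq, union_comm]
      exact subset_sdiff.2 ⟨h3, (subset_sdiff.1 h2).2⟩
    · rw [aux h1 h2] at hcon
      exact hcon.1

lemma isWave_of_contract_indep (hSW : S ⊆ W) (hW : W ⊆ M.E) (hM : W ⊆ M.closure S)
    (hN : (N ／ (N.E \ W)).Indep S) : IsWave M N W S := by
  refine ⟨hSW, hW, hM, fun s hs hcon ↦ hN.notMem_closure_sdiff_of_mem hs ?_⟩
  rw [contract_closure_eq]
  exact ⟨hcon, fun h ↦ h.2 (hSW hs)⟩

lemma IsWave.union (h : IsWave M N W S) (h' : IsWave (M ／ W) (N ／ S ＼ W) W' S') :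
    IsWave M N (W ∪ W') (S ∪ S') := by
  obtain ⟨h1, h2, h3, h4⟩ := (isWave_minor_iff h.subset).1 h'
  refine ⟨union_subset_union h.subset h1, union_subset h.subset_ground (h2.trans sdiff_subset),
    union_subset (h.subset_closure.trans (M.closure_subset_closure subset_union_left)) ?_, ?_⟩
  · refine h3.trans (closure_subset_closure_of_subset_closure (union_subset ?_ ?_))
    · exact h.subset_closure.trans (M.closure_subset_closure subset_union_left)
    · exact M.subset_closure_of_subset' subset_union_right (h1.trans (h2.trans sdiff_subset))
  · rintro s (hs | hs) hcon
    · refine h.notMem_closure s hs ?_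
      rw [← closure_inter_ground] at hcon
      refine N.closure_subset_closure (fun a ha ↦ ?_) hcon
      obtain ⟨⟨ha | ha, has⟩ | ha, haE⟩ := ha
      · exact .inl ⟨ha, has⟩
      · exact .inr ⟨haE, (h2 (h1 ha)).2⟩
      · exact .inr ⟨haE, fun h ↦ ha.2 (.inl h)⟩
    · refine h4 s hs (N.closure_subset_closure ?_ hcon)
      refine union_subset_union_left _ ?_
      rw [union_sdiff_distrib]
      exact union_subset_union_left _ sdiff_subset

lemma IsFeasible.union (hE : M.E = N.E) (h : IsFeasible M N Q I)
    (h' : IsFeasible (M ／ Q) (N ／ I ＼ Q) Q' I') : IsFeasible M N (Q ∪ Q') (I ∪ I') := by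
  have hb : M.IsBasis I Q := h.indep.isBasis_of_subset_of_subset_closure h.subset h.subset_closure
  have hQ' := h'.subset_ground
  have hI' := hb.contract_indep_iff.1 h'.indep
  have hdj : Disjoint Q' Q := (subset_sdiff.1 hQ').2
  have hQQ : Q ∪ Q' ⊆ M.E := union_subset h.subset_ground (hQ'.trans sdiff_subset)
  have hQ'N : Q' ⊆ N.closure (I ∪ I' ∪ (N.E \ (Q ∪ Q'))) := by
    have := h'.subset_closure_right
    rw [closure_contract_delete_eq N h.subset, ground_contract_delete_eq N h.subset,
      sdiff_sdiff, ← union_assoc] at this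
    · exact this.trans sdiff_subset
    rw [ground_contract_delete_eq N h.subset]
    refine disjoint_union_left.2 ⟨hI'.2.symm, ?_⟩
    exact disjoint_sdiff_left.mono_left sdiff_subset
  refine ⟨union_subset_union h.subset h'.subset, hQQ, union_comm I I' ▸ hI'.1, ?_, ?_, ?_⟩
  · refine union_subset (h.subset_closure.trans (M.closure_subset_closure subset_union_left)) ?_
    have := h'.subset_closure
    rw [contract_closure_eq, union_comm] at this
    refine this.trans (sdiff_subset.trans (closure_subset_closure_of_subset_closure ?_))
    refine union_subset (h.subset_closure.trans (M.closure_subset_closure subset_union_left)) ?_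
    exact M.subset_closure_of_subset' subset_union_right
      (h'.subset.trans (hQ'.trans sdiff_subset))
  · refine union_subset (h.subset_closure_right.trans
      (closure_subset_closure_of_subset_closure ?_)) hQ'N
    intro a ha
    have haE : a ∈ N.E := by
      obtain ha | ha := ha
      · exact hE ▸ h.subset_ground (h.subset ha)
      · exact ha.1
    by_cases haQ' : a ∈ Q'
    · exact hQ'N haQ'
    refine N.mem_closure_of_mem' ?_ haE
    obtain ha | ha := ha
    · exact .inl (.inl ha)
    · exact .inr ⟨haE, fun h ↦ h.elim ha.2 haQ'⟩
  · have := h'.loose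
    rwa [contract_contract, contract_delete_contract_delete _ _ _ _ _
      (hdj.mono_left h'.subset)] at this

/-- A maximal wave leaves a loose pair. -/
lemma exists_isWave_loose (M N : Matroid β) [M.Finitary] :
    ∃ W S, IsWave M N W S ∧ M.Indep S ∧ Loose (M ／ W) (N ／ S ＼ W) := by
  -- The wave is stored as `(S, W \ S)` and ordered in both coordinates, so a larger wave adds to
  -- `S` only elements outside the smaller `W`. This keeps the independence condition in the
  -- contraction of `N` valid for unions of chains.
  let P : Set (Set β × Set β) :=
    {p | Disjoint p.1 p.2 ∧ M.Indep p.1 ∧ IsWave M N (p.1 ∪ p.2) p.1}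
  obtain ⟨⟨S, T⟩, ⟨hdj, hS, hW⟩, hmax⟩ := zorn_le₀ P (by
    intro c hc hchain
    have hdir : ∀ p ∈ c, ∀ q ∈ c, ∃ r ∈ c, p ≤ r ∧ q ≤ r := fun p hp q hq ↦ by
      obtain h | h := hchain.total hp hq
      · exact ⟨q, hq, h, le_rfl⟩
      · exact ⟨p, hp, le_rfl, h⟩
    have hd : Disjoint (⋃ p ∈ c, p.1) (⋃ p ∈ c, p.2) := by
      simp only [disjoint_iUnion_left, disjoint_iUnion_right]
      intro q hq p hp
      obtain ⟨r, hr, hpr, hqr⟩ := hdir p hp q hq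
      exact (hc hr).1.mono hpr.1 hqr.2
    refine ⟨(⋃ p ∈ c, p.1, ⋃ p ∈ c, p.2), ⟨hd, ?_, ?_⟩, fun p hp ↦
      ⟨subset_biUnion_of_mem (u := fun p : Set β × Set β ↦ p.1) hp,
        subset_biUnion_of_mem (u := fun p : Set β × Set β ↦ p.2) hp⟩⟩
    · refine indep_of_forall_finite_subset_indep _ fun J hJ hJfin ↦ ?_
      obtain rfl | ⟨a, ha⟩ := J.eq_empty_or_nonempty
      · exact M.empty_indep
      have hne : c.Nonempty := by
        obtain ⟨p, hp, -⟩ := mem_iUnion₂.1 (hJ ha)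
        exact ⟨p, hp⟩
      clear ha
      obtain ⟨p, hp, hJp⟩ : ∃ p ∈ c, J ⊆ p.1 := by
        induction J, hJfin using Set.Finite.induction_on with
        | empty => exact ⟨_, hne.some_mem, empty_subset _⟩
        | @insert b J _ _ ih =>
          obtain ⟨p, hp, hbp⟩ := mem_iUnion₂.1 (hJ (mem_insert _ _))
          obtain ⟨q, hq, hJq⟩ := ih ((subset_insert _ _).trans hJ)
          obtain ⟨r, hr, hpr, hqr⟩ := hdir p hp q hq
          exact ⟨r, hr, insert_subset (hpr.1 hbp) (hJq.trans hqr.1)⟩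
      exact (hc hp).2.1.subset hJp
    · refine ⟨subset_union_left, ?_, ?_, ?_⟩
      · refine union_subset (iUnion₂_subset fun p hp ↦ ?_) (iUnion₂_subset fun p hp ↦ ?_)
        · exact subset_union_left.trans (hc hp).2.2.subset_ground
        · exact subset_union_right.trans (hc hp).2.2.subset_ground
      · refine union_subset (iUnion₂_subset fun p hp ↦ ?_) (iUnion₂_subset fun p hp ↦ ?_)
        · exact subset_union_left.trans ((hc hp).2.2.subset_closure.trans
            (M.closure_subset_closure (subset_biUnion_of_mem
              (u := fun p : Set β × Set β ↦ p.1) hp)))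
        · exact subset_union_right.trans ((hc hp).2.2.subset_closure.trans
            (M.closure_subset_closure (subset_biUnion_of_mem
              (u := fun p : Set β × Set β ↦ p.1) hp)))
      · intro s hs hcon
        obtain ⟨p, hp, hsp⟩ := mem_iUnion₂.1 hs
        refine (hc hp).2.2.notMem_closure s hsp ?_
        rw [← closure_inter_ground] at hcon
        refine N.closure_subset_closure (fun a ha ↦ ?_) hcon
        obtain ⟨⟨ha, has⟩ | ha, haE⟩ := ha
        · by_cases hap : a ∈ p.1
          · exact .inl ⟨hap, has⟩
          refine .inr ⟨haE, ?_⟩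
          rintro (h | h)
          · exact hap h
          · exact hd.notMem_of_mem_left ha (mem_biUnion hp h)
        · refine .inr ⟨haE, fun h ↦ ha.2 ?_⟩
          obtain h | h := h
          · exact .inl (mem_biUnion hp h)
          · exact .inr (mem_biUnion hp h))
  refine ⟨S ∪ T, S, hW, hS, fun W' S' h' ↦ ?_⟩
  -- Waves need not be `M`-independent, but the members of `P` are; thinning `S'` to a basis keeps
  -- it a wave.
  obtain ⟨S'', hS''⟩ := (M ／ (S ∪ T)).exists_isBasis S' (h'.subset.trans h'.subset_ground)
  have h'' : IsWave (M ／ (S ∪ T)) (N ／ S ＼ (S ∪ T)) W' S'' := by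
    refine ⟨hS''.subset.trans h'.subset, h'.subset_ground, ?_, fun s hs hcon ↦ ?_⟩
    · rw [hS''.closure_eq_closure]
      exact h'.subset_closure
    · refine h'.notMem_closure s (hS''.subset hs) (closure_subset_closure _ ?_ hcon)
      exact union_subset_union_left _ (sdiff_subset_sdiff_left hS''.subset)
  have hb : M.IsBasis S (S ∪ T) :=
    hS.isBasis_of_subset_of_subset_closure subset_union_left hW.subset_closure
  have hu := hW.union h''
  have hW' : Disjoint W' (S ∪ T) := (subset_sdiff.1 h''.subset_ground).2
  have hle := @hmax (S ∪ S'', (S ∪ T ∪ W') \ (S ∪ S'')) ⟨disjoint_sdiff_right, ?_, ?_⟩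
    ⟨subset_union_left, fun a ha ↦ ⟨.inl (.inr ha), ?_⟩⟩
  · refine eq_empty_of_forall_notMem fun a ha ↦ ?_
    have haST := hW'.notMem_of_mem_left ha
    by_cases haS : a ∈ S ∪ S''
    · exact haST (.inl (hle.1 haS))
    · exact haST (.inr (hle.2 ⟨.inr ha, haS⟩))
  · have := (hb.contract_indep_iff.1 hS''.indep).1
    rwa [union_comm] at this
  · dsimp only
    rwa [union_sdiff_cancel hu.subset]
  · rintro (h | h)
    · exact hdj.notMem_of_mem_left h ha
    · exact hW'.notMem_of_mem_left (h''.subset h) (.inr ha)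

end Wave

/-! ### Absorbing a single element in a loose pair. -/

section Step

variable {β : Type*} {M N : Matroid β} {W S Q : Set β} {u : β}

/-- In a loose pair, a wave `W` of the pair obtained by contracting `u` can be spanned in `N`
without using more elements of `W` than those in its distinguished spanning set. -/
lemma Loose.subset_closure_of_insert (hL : Loose M N) (hE : M.E = N.E) (hQ : Q ⊆ M.E)
    (hSu : M.Indep (insert u S)) (huS : u ∉ S) (hSQ : insert u S ⊆ Q)
    (hQM : Q ⊆ M.closure (insert u S))
    (hN : ∀ s ∈ S, s ∉ N.closure (insert u (S \ {s}) ∪ (N.E \ Q))) :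
    Q ⊆ N.closure (insert u S ∪ (N.E \ Q)) := by
  by_contra hcon
  obtain ⟨f, hfQ, hf⟩ := not_subset.1 hcon
  have hQne : Q ≠ ∅ := by
    rintro rfl
    exact hfQ
  have hsub : S ⊆ Q := (subset_insert _ _).trans hSQ
  -- If `u` is not spanned here, `insert u S` is independent in the contraction of `N` onto `Q`, and
  -- `Q` is itself a wave.
  by_cases hu : u ∈ N.closure (S ∪ (N.E \ Q))
  swap
  · refine hQne (hL Q (insert u S) ⟨hSQ, hQ, hQM, ?_⟩)
    rintro s (rfl | hs) hcl
    · exact hu (N.closure_subset_closure (union_subset_union_left _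
        (by simp [sdiff_subset_iff])) hcl)
    · refine hN s hs ?_
      rwa [insert_sdiff_of_notMem _ (by rintro rfl; exact huS hs)] at hcl
  set M' := M ↾ Q with hM'
  set N' := N ／ (N.E \ Q) with hN'
  have hE' : M'.E = N'.E := by
    rw [hM', hN', restrict_ground_eq, contract_ground, sdiff_sdiff_cancel_left (hE ▸ hQ)]
  have hM'E : M'.E = Q := rfl
  have hM'cl : ∀ X ⊆ Q, M'.closure X = M.closure X ∩ Q := fun X hX ↦
    restrict_closure_eq M hX hQ
  have hN'cl : ∀ X, N'.closure X = N.closure (X ∪ (N.E \ Q)) \ (N.E \ Q) := fun X ↦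
    contract_closure_eq N _ X
  have hclu : N.closure (insert u S ∪ (N.E \ Q)) = N.closure (S ∪ (N.E \ Q)) := by
    rw [insert_union, closure_insert_eq_of_mem_closure hu]
  rw [hclu] at hf
  have hf' : f ∉ N'.closure S := fun h ↦ hf ((hN'cl S ▸ h).1)
  have hSM' : M'.Indep S := restrict_indep_iff.2 ⟨hSu.subset (subset_insert _ _), hsub⟩
  have hSN' : N'.Indep S := by
    refine (indep_iff_forall_notMem_closure_sdiff (hE' ▸ hM'E ▸ hsub)).2 fun s hs hcl ↦ ?_
    rw [hN'cl] at hcl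
    exact hN s hs (N.closure_subset_closure (union_subset_union_left _ (subset_insert _ _)) hcl.1)
  have hbase : M'.closure (insert u S) = M'.E := by
    rw [hM'cl _ hSQ, hM'E, inter_eq_right]
    exact hQM
  -- Either all reachable elements are `N'`-spanned by `S`, and the unreachable part of `Q` is a
  -- wave containing `f`, or some reachable `r` completes a swapped `S` to a set spanning `M'` and
  -- independent in `N'`, which makes `Q` a wave.
  by_cases hR : swapReach M' N' S ⊆ N'.closure S
  · have hfR : f ∉ swapReach M' N' S := fun h ↦ hf' (hR h)
    have hV : IsWave M N (Q \ swapReach M' N' S) (S \ swapReach M' N' S) := by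
      have h1 := sdiff_swapReach_subset_closure (N := N') hSM'
      rw [hM'cl _ (sdiff_subset.trans hsub), hM'E] at h1
      have h2 := swapReach_inter_closure_subset hE' hSM'
      rw [inter_eq_left.2 hR, hN'cl] at h2
      refine ⟨sdiff_subset_sdiff_left hsub, sdiff_subset.trans hQ, h1.trans inter_subset_left,
        fun s hs hcl ↦ hN s hs.1 ?_⟩
      refine N.closure_subset_closure (union_subset_union_left _ (subset_insert u _)) ?_
      rw [← closure_inter_ground] at hcl
      refine closure_subset_closure_of_subset_closure ?_ hcl
      rintro a ⟨⟨ha, has⟩ | ha, haE⟩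
      · exact N.mem_closure_of_mem' (.inl ⟨ha.1, has⟩) haE
      · by_cases haQ : a ∈ Q
        · have haR : a ∈ swapReach M' N' S := by
            by_contra h
            exact ha.2 ⟨haQ, h⟩
          refine N.closure_subset_closure (union_subset_union_left _ ?_) (h2 haR).1
          rintro b ⟨hbS, hbR⟩
          refine ⟨hbS, ?_⟩
          rintro rfl
          exact hs.2 hbR
        · exact N.mem_closure_of_mem' (.inr ⟨haE, haQ⟩) haE
    have := hL _ _ hV
    exact (this ▸ (⟨hfQ, hfR⟩ : f ∈ Q \ swapReach M' N' S) : f ∈ (∅ : Set β))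
  · obtain ⟨r, ⟨hrE, J, hJ, hrJ⟩, hrN⟩ := not_subset.1 hR
    have hJM := hJ.indep hSM'
    have hJN := hJ.indep_right hSN'
    have hrJQ : insert r J ⊆ Q := insert_subset hrE hJM.subset_ground
    have hN'i : N'.Indep (insert r J) :=
      hJN.insert_indep_iff.2 (.inl ⟨hE' ▸ hrE, by rwa [hJ.closure_eq]⟩)
    refine hQne (hL Q (insert r J) (isWave_of_contract_indep hrJQ hQ ?_ hN'i))
    have := hJ.closure_insert_eq_ground hbase hrE hrJ
    rw [hM'cl _ hrJQ, hM'E, inter_eq_right] at this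
    exact this

/-- In a loose pair, every element is contained in the first set of a feasible pair. -/
lemma Loose.exists_isFeasible_mem [M.Finitary] (hL : Loose M N) (hE : M.E = N.E) (hu : u ∈ M.E) :
    ∃ Q I, IsFeasible M N Q I ∧ u ∈ Q := by
  obtain ⟨W, S, hW, hS, hWL⟩ := exists_isWave_loose (M ／ {u}) (N ／ {u} ＼ {u})
  have hunl : M.Indep {u} := by
    by_contra hcon
    have hloop : u ∈ M.closure ∅ := by
      by_contra h
      refine hcon ?_
      rw [← insert_empty_eq]
      exact M.empty_indep.insert_indep_iff.2 (.inl ⟨hu, h⟩)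
    have := hL {u} ∅ ⟨empty_subset _, by simpa, by simpa, by simp⟩
    simp at this
  obtain ⟨h1, h2, h3, h4⟩ := (isWave_minor_iff Subset.rfl).1 hW
  have hSi := hunl.contract_indep_iff.1 hS
  have huS : u ∉ S := fun h ↦ hSi.1.notMem_of_mem_left h rfl
  have hb : M.Indep (insert u S) := by
    rw [← union_singleton]
    exact hSi.2
  have hWu : Disjoint W {u} := (subset_sdiff.1 h2).2
  have hQ : insert u W ⊆ M.E := insert_subset hu (h2.trans sdiff_subset)
  have hcl : insert u W ⊆ M.closure (insert u S) :=
    insert_subset (M.mem_closure_of_mem' (.inl rfl) hu) h3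
  refine ⟨insert u W, insert u S, ⟨insert_subset_insert h1, hQ, hb, hcl, ?_, ?_⟩, .inl rfl⟩
  · refine hL.subset_closure_of_insert hE hQ hb huS (insert_subset_insert h1) hcl fun s hs ↦ ?_
    have := h4 s hs
    rwa [singleton_union, singleton_union] at this
  · rwa [contract_contract, contract_delete_contract_delete _ _ _ _ _ (hWu.mono_left h1),
      singleton_union, singleton_union] at hWL

end Step

/-! ### Augmenting a base of `M` to span more in `N`. -/

section Augment

variable {β : Type*} {M N : Matroid β} {I I' V W Z T : Set β} {x : β}

/-- `I'` arises from `I` by swaps that start with the removal of an element which is redundant in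
`N`, and end with the insertion of an element which is not spanned by `I` in `N`. -/
def AugStep (M N : Matroid β) (I I' : Set β) : Prop :=
  ∃ x ∈ I, x ∈ N.closure (I \ {x}) ∧ ∃ J r, Swaps M N (I \ {x}) J ∧ r ∈ M.E ∧ r ∉ M.closure J ∧
    r ∉ N.closure I ∧ I' = insert r J

/-- `I'` arises from `I` by finitely many augmentation steps. -/
def Augs (M N : Matroid β) : Set β → Set β → Prop := Relation.ReflTransGen (AugStep M N)

lemma AugStep.isBase (h : AugStep M N I I') (hI : M.IsBase I) : M.IsBase I' := by
  obtain ⟨x, hxI, hx, J, r, hs, hrE, hrJ, -, rfl⟩ := h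
  have hJ := hs.indep (hI.indep.subset sdiff_subset)
  have hb : M.closure (insert x (I \ {x})) = M.E := by
    rw [insert_sdiff_singleton, insert_eq_of_mem hxI, hI.closure_eq]
  exact (hJ.insert_indep_iff.2 (.inl ⟨hrE, hrJ⟩)).isBase_of_ground_subset_closure
    (hs.closure_insert_eq_ground hb hrE hrJ).symm.subset

lemma Augs.isBase (h : Augs M N I I') (hI : M.IsBase I) : M.IsBase I' := by
  induction h with
  | refl => exact hI
  | tail _ h ih => exact h.isBase ih

lemma AugStep.closure_subset (h : AugStep M N I I') : N.closure I ⊆ N.closure I' := by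
  obtain ⟨x, hxI, hx, J, r, hs, hrE, hrJ, hr, rfl⟩ := h
  rw [← closure_sdiff_singleton_eq_closure hx, ← hs.closure_eq]
  exact N.closure_subset_closure (subset_insert _ _)

lemma Augs.closure_subset (h : Augs M N I I') : N.closure I ⊆ N.closure I' := by
  induction h with
  | refl => rfl
  | tail _ h ih => exact ih.trans h.closure_subset

lemma AugStep.finite_sdiff (h : AugStep M N I I') : (I' \ I).Finite ∧ (I \ I').Finite := by
  obtain ⟨x, hxI, hx, J, r, hs, hrE, hrJ, hr, rfl⟩ := h
  obtain ⟨h1, h2⟩ := hs.finite_sdiff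
  refine ⟨((h1.insert x).insert r).subset fun a ha ↦ ?_, (h2.insert x).subset fun a ha ↦ ?_⟩ <;>
  · simp only [mem_sdiff, mem_insert_iff, mem_singleton_iff] at ha ⊢
    tauto

lemma Augs.finite_sdiff (h : Augs M N I I') : (I' \ I).Finite ∧ (I \ I').Finite := by
  induction h with
  | refl => simp
  | tail _ h ih =>
    obtain ⟨h1, h2⟩ := h.finite_sdiff
    refine ⟨(ih.1.union h1).subset fun a ha ↦ ?_, (ih.2.union h2).subset fun a ha ↦ ?_⟩ <;>
    · simp only [mem_sdiff, mem_union] at ha ⊢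
      tauto

/-- The set `V` is spanned in `M` by `I ∩ V`, and the elements outside `V` that are spanned by `I`
in `N` are already spanned by `I \ V`. -/
structure IsTight (M N : Matroid β) (I V : Set β) : Prop where
  subset_ground : V ⊆ M.E
  subset_closure : V ⊆ M.closure (I ∩ V)
  closure_sdiff_subset : N.closure I \ V ⊆ N.closure (I \ V)

/-- The smallest tight set containing `Z`. -/
def tightHull (M N : Matroid β) (I Z : Set β) : Set β := ⋂₀ {V | IsTight M N I V ∧ Z ⊆ V}

lemma subset_tightHull : Z ⊆ tightHull M N I Z := subset_sInter fun _ hV ↦ hV.2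

lemma IsTight.tightHull_subset (h : IsTight M N I V) (hZ : Z ⊆ V) : tightHull M N I Z ⊆ V :=
  sInter_subset_of_mem ⟨h, hZ⟩

lemma isTight_ground (hE : M.E = N.E) (hI : M.IsBase I) : IsTight M N I M.E := by
  refine ⟨Subset.rfl, ?_, ?_⟩
  · rw [inter_eq_self_of_subset_left hI.subset_ground, hI.closure_eq]
  · rw [hE, sdiff_eq_empty.2 (N.closure_subset_ground I)]
    exact empty_subset _

/-- Closures of subsets of the independent set `I` commute with intersections in `M`, and the
condition in `N` can be read off from any single tight set avoiding the given element. -/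
lemma isTight_tightHull (hE : M.E = N.E) (hI : M.IsBase I) (hZ : Z ⊆ M.E) :
    IsTight M N I (tightHull M N I Z) := by
  have hEmem : M.E ∈ {V | IsTight M N I V ∧ Z ⊆ V} := ⟨isTight_ground hE hI, hZ⟩
  refine ⟨sInter_subset_of_mem hEmem, ?_, ?_⟩
  · have hcl := hI.indep.closure_sInter_eq_biInter_closure_of_forall_subset
      (Js := (I ∩ ·) '' {V | IsTight M N I V ∧ Z ⊆ V}) (Nonempty.image _ ⟨_, hEmem⟩)
      (by rintro _ ⟨V, -, rfl⟩; exact inter_subset_left)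
    have heq : ⋂₀ ((I ∩ ·) '' {V | IsTight M N I V ∧ Z ⊆ V}) ⊆ I ∩ tightHull M N I Z := by
      intro a ha
      refine ⟨(ha _ ⟨_, hEmem, rfl⟩).1, fun V hV ↦ (ha _ ⟨V, hV, rfl⟩).2⟩
    refine Subset.trans ?_ (M.closure_subset_closure heq)
    rw [hcl]
    refine subset_iInter₂ ?_
    rintro _ ⟨V, hV, rfl⟩
    exact (sInter_subset_of_mem hV).trans hV.1.subset_closure
  · rintro a ⟨haI, ha⟩
    obtain ⟨V, hV, haV⟩ : ∃ V, (IsTight M N I V ∧ Z ⊆ V) ∧ a ∉ V := by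
      simpa [tightHull, and_assoc] using ha
    exact N.closure_subset_closure (sdiff_subset_sdiff_right (sInter_subset_of_mem hV))
      (hV.1.closure_sdiff_subset ⟨haI, haV⟩)

/-- No element of `Z` becomes spanned in `N` after augmenting `I`. -/
def Unreachable (M N : Matroid β) (I Z : Set β) : Prop :=
  ∀ I', Augs M N I I' → Disjoint Z (N.closure I')

lemma Unreachable.mono (h : Unreachable M N I Z) (hI : Augs M N I I') : Unreachable M N I' Z :=
  fun _ h' ↦ h _ (hI.trans h')

/-- The complement of the reach is tight, and it contains `Z` since a reachable `z ∈ Z` would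
complete an augmentation. -/
lemma Unreachable.tightHull_subset (h : Unreachable M N I Z) (hE : M.E = N.E) (hI : M.IsBase I)
    (hZ : Z ⊆ M.E) (hxI : x ∈ I) (hx : x ∈ N.closure (I \ {x})) :
    tightHull M N I Z ⊆ M.E \ swapReach M N (I \ {x}) := by
  have hi : M.Indep (I \ {x}) := hI.indep.subset sdiff_subset
  have hxR : x ∈ swapReach M N (I \ {x}) :=
    ⟨hI.subset_ground hxI, _, .refl, hI.indep.notMem_closure_sdiff_of_mem hxI⟩
  refine IsTight.tightHull_subset ⟨sdiff_subset, ?_, ?_⟩ ?_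
  · refine (sdiff_swapReach_subset_closure hi).trans (M.closure_subset_closure ?_)
    exact fun a ha ↦ ⟨ha.1.1, hI.subset_ground ha.1.1, ha.2⟩
  · rintro a ⟨ha, haV⟩
    have haR : a ∈ swapReach M N (I \ {x}) := by
      by_contra hcon
      exact haV ⟨hE ▸ N.closure_subset_ground _ ha, hcon⟩
    have hsub : (I \ {x}) ∩ swapReach M N (I \ {x}) ⊆ I \ (M.E \ swapReach M N (I \ {x})) :=
      fun b hb ↦ ⟨hb.1.1, fun h ↦ h.2 hb.2⟩
    refine N.closure_subset_closure hsub
      (swapReach_inter_closure_subset hE hi ⟨haR, ?_⟩)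
    rwa [closure_sdiff_singleton_eq_closure hx]
  · refine fun z hz ↦ ⟨hZ hz, ?_⟩
    rintro ⟨hzE, J, hJ, hzJ⟩
    have hzI : z ∉ N.closure I := (h I .refl).notMem_of_mem_left hz
    refine (h (insert z J) (.single ⟨x, hxI, hx, J, z, hJ, hzE, hzJ, hzI, rfl⟩)).notMem_of_mem_left
      hz (N.mem_closure_of_mem' (.inl rfl) (hE ▸ hzE))

lemma Unreachable.notMem_closure (h : Unreachable M N I Z) (hE : M.E = N.E) (hI : M.IsBase I)
    (hZ : Z ⊆ M.E) (hxI : x ∈ I) (hxV : x ∈ tightHull M N I Z) : x ∉ N.closure (I \ {x}) :=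
  fun hx ↦ (h.tightHull_subset hE hI hZ hxI hx hxV).2
    ⟨hI.subset_ground hxI, _, .refl, hI.indep.notMem_closure_sdiff_of_mem hxI⟩

/-- The hull lies outside the reach, so an augmentation leaves the base unchanged there. This
stability is what lets hulls of successive bases be united into one wave. -/
lemma AugStep.tightHull_subset (hs : AugStep M N I I') (h : Unreachable M N I Z) (hE : M.E = N.E)
    (hI : M.IsBase I) (hZ : Z ⊆ M.E) :
    tightHull M N I Z ⊆ tightHull M N I' Z ∧
      I' ∩ tightHull M N I Z = I ∩ tightHull M N I Z := by
  have hs' := hs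
  have hI' := hs.isBase hI
  obtain ⟨x, hxI, hx, J, r, hsw, hrE, hrJ, hrN, rfl⟩ := hs
  have hi : M.Indep (I \ {x}) := hI.indep.subset sdiff_subset
  have hVR := h.tightHull_subset hE hI hZ hxI hx
  have hV := isTight_tightHull hE hI hZ
  set V := tightHull M N I Z
  have hxR : x ∈ swapReach M N (I \ {x}) :=
    ⟨hI.subset_ground hxI, _, .refl, hI.indep.notMem_closure_sdiff_of_mem hxI⟩
  have hrR : r ∈ swapReach M N (I \ {x}) := ⟨hrE, J, hsw, hrJ⟩
  have hJR := hsw.sdiff_swapReach hi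
  have hclJ : N.closure J = N.closure I := by
    rw [hsw.closure_eq, closure_sdiff_singleton_eq_closure hx]
  have hJN : J ⊆ N.E := hE ▸ (hsw.indep hi).subset_ground
  have hIN : I ⊆ N.E := hE ▸ hI.subset_ground
  have heq : insert r J ∩ V = I ∩ V := by
    ext a
    constructor
    · rintro ⟨rfl | ha, haV⟩
      · exact ((hVR haV).2 hrR).elim
      · have : a ∈ J \ swapReach M N (I \ {x}) := ⟨ha, (hVR haV).2⟩
        rw [hJR] at this
        exact ⟨this.1.1, haV⟩
    · rintro ⟨ha, haV⟩
      have : a ∈ (I \ {x}) \ swapReach M N (I \ {x}) := by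
        refine ⟨⟨ha, ?_⟩, (hVR haV).2⟩
        rintro rfl
        exact (hVR haV).2 hxR
      rw [← hJR] at this
      exact ⟨.inr this.1, haV⟩
  -- A set `W` tight for the new base gives `W ∩ V` tight for the old one, so minimality of `V`
  -- yields `V ⊆ W`.
  refine ⟨subset_sInter fun W ⟨hW, hZW⟩ ↦ ?_, heq⟩
  suffices hT : IsTight M N I (W ∩ V) from
    (hT.tightHull_subset (subset_inter hZW subset_tightHull)).trans inter_subset_left
  refine ⟨inter_subset_right.trans hV.subset_ground, ?_, ?_⟩
  · rintro v ⟨hvW, hvV⟩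
    have hsub : (insert r J ∩ W) ∪ (insert r J ∩ V) ⊆ insert r J :=
      union_subset inter_subset_left inter_subset_left
    have := (hI'.indep.subset hsub).closure_inter_eq_inter_closure
    have hv : v ∈ M.closure (insert r J ∩ W ∩ (insert r J ∩ V)) := by
      rw [this]
      refine ⟨hW.subset_closure hvW, ?_⟩
      rw [heq]
      exact hV.subset_closure hvV
    refine M.closure_subset_closure ?_ hv
    rw [heq]
    exact fun a ha ↦ ⟨ha.2.1, ha.1.2, ha.2.2⟩
  · rintro d ⟨hdI, hdVW⟩
    by_cases hdV : d ∈ V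
    swap
    · exact N.closure_subset_closure (sdiff_subset_sdiff_right inter_subset_right)
        (hV.closure_sdiff_subset ⟨hdI, hdV⟩)
    have hdW : d ∉ W := fun h ↦ hdVW ⟨h, hdV⟩
    have hdW' := hW.closure_sdiff_subset ⟨hs'.closure_subset hdI, hdW⟩
    have hd : d ∈ N.closure (insert r (I \ (W ∩ V))) := by
      refine closure_subset_closure_of_subset_closure ?_ hdW'
      rintro a ⟨rfl | ha, haW⟩
      · exact N.mem_closure_of_mem' (.inl rfl) (hE ▸ hrE)
      by_cases haV : a ∈ V
      · have : a ∈ I ∩ V := heq ▸ ⟨.inr ha, haV⟩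
        exact N.mem_closure_of_mem' (.inr ⟨this.1, fun h ↦ haW h.1⟩) (hJN ha)
      · have haI : a ∈ N.closure I := hclJ ▸ N.mem_closure_of_mem ha hJN
        refine N.closure_subset_closure ?_ (hV.closure_sdiff_subset ⟨haI, haV⟩)
        exact (sdiff_subset_sdiff_right inter_subset_right).trans (subset_insert _ _)
    -- If `r` were needed to span `d`, exchange would place `r` in the `N`-closure of `I`.
    by_contra hcon
    refine hrN (closure_subset_closure_of_subset_closure ?_ (mem_closure_insert hcon hd))
    exact insert_subset hdI (sdiff_subset.trans (N.subset_closure I hIN))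

lemma Augs.tightHull_subset (hs : Augs M N I I') (h : Unreachable M N I Z) (hE : M.E = N.E)
    (hI : M.IsBase I) (hZ : Z ⊆ M.E) :
    tightHull M N I Z ⊆ tightHull M N I' Z ∧
      I' ∩ tightHull M N I Z = I ∩ tightHull M N I Z := by
  induction hs with
  | refl => exact ⟨Subset.rfl, rfl⟩
  | @tail K K' hs hst ih =>
    obtain ⟨h1, h2⟩ := hst.tightHull_subset (h.mono hs) hE (Augs.isBase hs hI) hZ
    refine ⟨ih.1.trans h1, ?_⟩
    rw [← ih.2, ← inter_eq_self_of_subset_right ih.1, ← inter_assoc, h2, inter_assoc]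

lemma tightHull_mono {Z' : Set β} (hZ : Z ⊆ Z') : tightHull M N I Z ⊆ tightHull M N I Z' :=
  sInter_subset_sInter fun _ hV ↦ ⟨hV.1, hZ.trans hV.2⟩

/-- In a loose pair, every base of `M` can be augmented to span a given finite set in `N`. -/
theorem Loose.exists_augs [N.Finitary] (hL : Loose M N) (hE : M.E = N.E) (hc : M.E.Countable)
    (hI : M.IsBase I) (hT : T.Finite) (hTE : T ⊆ M.E) :
    ∃ I', Augs M N I I' ∧ T ⊆ N.closure I' := by
  obtain hemp | hne := M.E.eq_empty_or_nonempty
  · exact ⟨I, .refl, by rw [hemp] at hTE; exact hTE.trans (empty_subset _)⟩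
  obtain ⟨f, hf⟩ := hc.exists_eq_range hne
  have hex : ∀ K e, ∃ K', Augs M N K K' ∧
      (e ∈ N.closure K' ∨ ∀ L, Augs M N K' L → e ∉ N.closure L) := by
    intro K e
    by_cases h : ∃ K', Augs M N K K' ∧ e ∈ N.closure K'
    · obtain ⟨K', h1, h2⟩ := h
      exact ⟨K', h1, .inl h2⟩
    · push Not at h
      exact ⟨K, .refl, .inr h⟩
  choose g hg1 hg2 using hex
  let s : ℕ → Set β := fun n ↦ Nat.rec I (fun n K ↦ g K (f n)) n
  have hs1 : ∀ n, s (n + 1) = g (s n) (f n) := fun n ↦ rfl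
  have hsm : ∀ m n, m ≤ n → Augs M N (s m) (s n) := by
    intro m n hmn
    induction n, hmn using Nat.le_induction with
    | base => exact .refl
    | succ n _ ih =>
      rw [hs1]
      exact ih.trans (hg1 _ _)
  have hbase : ∀ n, M.IsBase (s n) := fun n ↦ (hsm 0 n n.zero_le).isBase hI
  -- The elements already lost for good at stage `n`. Their hulls increase with `n`, and the union
  -- will be a wave, so nothing is ever lost.
  let Y : ℕ → Set β := fun n ↦ {e | e ∈ M.E ∧ ∀ L, Augs M N (s n) L → e ∉ N.closure L}
  have hYE : ∀ n, Y n ⊆ M.E := fun n e he ↦ he.1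
  have hYu : ∀ n, Unreachable M N (s n) (Y n) := fun n L hL ↦
    disjoint_left.2 fun e he ↦ he.2 L hL
  have hYm : ∀ m n, m ≤ n → Y m ⊆ Y n := fun m n hmn e he ↦
    ⟨he.1, fun L hL ↦ he.2 L ((hsm m n hmn).trans hL)⟩
  let V : ℕ → Set β := fun n ↦ tightHull M N (s n) (Y n)
  have hVt : ∀ n, IsTight M N (s n) (V n) := fun n ↦ isTight_tightHull hE (hbase n) (hYE n)
  have hVm : ∀ m n, m ≤ n → V m ⊆ V n := fun m n hmn ↦
    ((hsm m n hmn).tightHull_subset (hYu m) hE (hbase m) (hYE m)).1.trans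
      (tightHull_mono (hYm m n hmn))
  have hVs : ∀ m n, m ≤ n → s n ∩ V m = s m ∩ V m := fun m n hmn ↦
    ((hsm m n hmn).tightHull_subset (hYu m) hE (hbase m) (hYE m)).2
  have hspan : ∀ e ∈ M.E, (∀ n, e ∉ Y n) → ∃ n, e ∈ N.closure (s n) := by
    intro e he hY
    obtain ⟨n, rfl⟩ : e ∈ range f := hf ▸ he
    refine ⟨n + 1, (hg2 (s n) (f n)).resolve_right fun h ↦ hY (n + 1) ⟨he, h⟩⟩
  have hwave : IsWave M N (⋃ n, V n) (⋃ n, s n ∩ V n) := by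
    refine ⟨iUnion_mono fun n ↦ inter_subset_right, iUnion_subset fun n ↦ (hVt n).subset_ground,
      iUnion_subset fun n ↦ (hVt n).subset_closure.trans
        (M.closure_subset_closure (subset_iUnion (fun n ↦ s n ∩ V n) n)), fun t ht hcon ↦ ?_⟩
    obtain ⟨k, htk⟩ := mem_iUnion.1 ht
    have htm : ∀ m, k ≤ m → t ∈ s m ∧ t ∈ V m := by
      intro m hm
      have : t ∈ s m ∩ V k := (hVs k m hm).symm ▸ htk
      exact ⟨this.1, hVm k m hm this.2⟩
    -- A dependency uses finitely many elements, so it is already present at some stage `m`, making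
    -- `t` redundant in `N` although `t` lies in the hull `V m`.
    obtain ⟨F, hFsub, hFfin, -, hF⟩ := exists_mem_finite_closure_of_mem_closure hcon
    have hev : ∀ a ∈ F, ∀ᶠ m in Filter.atTop, a ∈ N.closure (s m \ {t}) := by
      intro a ha
      obtain ⟨ha', hat⟩ | ha := hFsub ha
      · obtain ⟨n, hn⟩ := mem_iUnion.1 ha'
        filter_upwards [Filter.eventually_ge_atTop n] with m hm
        have : a ∈ s m ∩ V n := (hVs n m hm).symm ▸ hn
        exact (N.mem_closure_of_mem' ⟨this.1, hat⟩ (hE ▸ (hbase m).subset_ground this.1))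
      · have haV : ∀ n, a ∉ V n := fun n h ↦ ha.2 (mem_iUnion.2 ⟨n, h⟩)
        obtain ⟨n, hn⟩ := hspan a (hE ▸ ha.1) fun n h ↦ haV n (subset_tightHull h)
        filter_upwards [Filter.eventually_ge_atTop n, Filter.eventually_ge_atTop k] with m hm hkm
        refine (N.closure_subset_closure ?_ ((hVt m).closure_sdiff_subset
          ⟨(hsm n m hm).closure_subset hn, haV m⟩))
        refine sdiff_subset_sdiff_right ?_
        exact singleton_subset_iff.2 (htm m hkm).2
    obtain ⟨m, hm, hkm⟩ := (((Filter.eventually_all_finite hFfin).2 hev).and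
      (Filter.eventually_ge_atTop k)).exists
    obtain ⟨h1, h2⟩ := htm m hkm
    refine (hYu m).notMem_closure hE (hbase m) (hYE m) h1 h2 ?_
    exact closure_subset_closure_of_subset_closure hm hF
  have hVe := hL _ _ hwave
  have hY : ∀ e n, e ∉ Y n := fun e n he ↦
    (hVe ▸ mem_iUnion.2 ⟨n, subset_tightHull he⟩ : e ∈ (∅ : Set β))
  have hev : ∀ a ∈ T, ∀ᶠ m in Filter.atTop, a ∈ N.closure (s m) := by
    intro a ha
    obtain ⟨n, hn⟩ := hspan a (hTE ha) (hY a)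
    filter_upwards [Filter.eventually_ge_atTop n] with m hm
    exact (hsm n m hm).closure_subset hn
  obtain ⟨m, hm⟩ := ((Filter.eventually_all_finite hT).2 hev).exists
  exact ⟨s m, hsm 0 m m.zero_le, hm⟩

end Augment

/-! ### Matroid intersection for two finitary matroids. -/

section Intersection

variable {β : Type*} {M N : Matroid β} {I I' Q T W S X : Set β} {e : β}

lemma Loose.isFeasible_empty (hL : Loose M N) : IsFeasible M N ∅ ∅ :=
  ⟨Subset.rfl, empty_subset _, M.empty_indep, empty_subset _, empty_subset _, by simpa⟩

lemma Loose.minor_mono (hL : Loose (M ／ Q) (N ／ I ＼ Q)) (hI : I ⊆ Q) (hI' : I' ⊆ Q)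
    (hII' : I ⊆ N.closure I') : Loose (M ／ Q) (N ／ I' ＼ Q) := by
  intro W S hW
  obtain ⟨h1, h2, h3, h4⟩ := (isWave_minor_iff hI').1 hW
  refine hL W S ((isWave_minor_iff hI).2 ⟨h1, h2, h3, fun s hs hcon ↦ h4 s hs ?_⟩)
  rw [← closure_inter_ground] at hcon
  refine closure_subset_closure_of_subset_closure ?_ hcon
  rintro a ⟨(ha | ha) | ha, haE⟩
  · exact N.closure_subset_closure (subset_union_left.trans subset_union_left) (hII' ha)
  · exact N.mem_closure_of_mem' (.inl (.inr ha)) haE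
  · exact N.mem_closure_of_mem' (.inr ha) haE

/-- Feasible pairs can be extended countably often, handling one element at a time. -/
lemma Loose.exists_chain (hL : Loose M N) (hc : M.E.Countable) (P : β → Set β → Set β → Prop)
    (hstep : ∀ Q I e, IsFeasible M N Q I → e ∈ M.E →
      ∃ Q' I', IsFeasible M N Q' I' ∧ Q ⊆ Q' ∧ I ⊆ I' ∧ P e Q' I') :
    ∃ Qs Is : ℕ → Set β, Monotone Qs ∧ Monotone Is ∧ (∀ n, IsFeasible M N (Qs n) (Is n)) ∧
      ∀ e ∈ M.E, ∃ n, P e (Qs n) (Is n) := by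
  obtain hemp | hne := M.E.eq_empty_or_nonempty
  · exact ⟨fun _ ↦ ∅, fun _ ↦ ∅, monotone_const, monotone_const, fun _ ↦ hL.isFeasible_empty,
      by simp [hemp]⟩
  obtain ⟨f, hf⟩ := hc.exists_eq_range hne
  have hstep' : ∀ (p : {p : Set β × Set β // IsFeasible M N p.1 p.2}) (n : ℕ),
      ∃ q : {p : Set β × Set β // IsFeasible M N p.1 p.2}, p.1 ≤ q.1 ∧ P (f n) q.1.1 q.1.2 := by
    rintro ⟨⟨Q, I⟩, h⟩ n
    obtain ⟨Q', I', h1, h2, h3, h4⟩ := hstep Q I (f n) h (hf ▸ mem_range_self n)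
    exact ⟨⟨(Q', I'), h1⟩, ⟨h2, h3⟩, h4⟩
  choose g hg1 hg2 using hstep'
  let s : ℕ → {p : Set β × Set β // IsFeasible M N p.1 p.2} :=
    fun n ↦ Nat.rec ⟨(∅, ∅), hL.isFeasible_empty⟩ (fun n p ↦ g p n) n
  have hs : Monotone fun n ↦ (s n).1 := monotone_nat_of_le_succ fun n ↦ hg1 (s n) n
  refine ⟨fun n ↦ (s n).1.1, fun n ↦ (s n).1.2, fun m n h ↦ (hs h).1, fun m n h ↦ (hs h).2,
    fun n ↦ (s n).2, fun e he ↦ ?_⟩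
  obtain ⟨n, rfl⟩ : e ∈ range f := hf ▸ he
  exact ⟨n + 1, hg2 (s n) n⟩

lemma indep_iUnion_of_monotone [M.Finitary] {Is : ℕ → Set β} (hm : Monotone Is)
    (hI : ∀ n, M.Indep (Is n)) : M.Indep (⋃ n, Is n) := by
  refine indep_of_forall_finite_subset_indep _ fun J hJ hJfin ↦ ?_
  have hev : ∀ a ∈ J, ∀ᶠ n in Filter.atTop, a ∈ Is n := by
    intro a ha
    obtain ⟨n, hn⟩ := mem_iUnion.1 (hJ ha)
    filter_upwards [Filter.eventually_ge_atTop n] with m hm'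
    exact hm hm' hn
  obtain ⟨n, hn⟩ := ((Filter.eventually_all_finite hJfin).2 hev).exists
  exact (hI n).subset hn

/-- In a loose pair, some feasible pair spans a given finite set in `N`. -/
lemma Loose.exists_isFeasible_closure [M.Finitary] [N.Finitary] (hL : Loose M N) (hE : M.E = N.E)
    (hc : M.E.Countable) (hT : T.Finite) (hTE : T ⊆ M.E) :
    ∃ Q I, IsFeasible M N Q I ∧ T ⊆ N.closure I := by
  obtain ⟨Qs, Is, hQm, hIm, hf, hQ⟩ := hL.exists_chain hc (fun e Q _ ↦ e ∈ Q) (by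
    intro Q I e h he
    by_cases heQ : e ∈ Q
    · exact ⟨Q, I, h, Subset.rfl, Subset.rfl, heQ⟩
    obtain ⟨Q', I', h', he'⟩ := h.loose.exists_isFeasible_mem
      (by rw [contract_ground, ground_contract_delete_eq N h.subset, hE]) (u := e) ⟨he, heQ⟩
    exact ⟨_, _, h.union hE h', subset_union_left, subset_union_left, .inr he'⟩)
  have hi := indep_iUnion_of_monotone hIm fun n ↦ (hf n).indep
  set I := ⋃ n, Is n
  have hIb : M.IsBase I := by
    refine hi.isBase_of_ground_subset_closure fun e he ↦ ?_
    obtain ⟨n, hn⟩ := hQ e he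
    exact M.closure_subset_closure (subset_iUnion _ n) ((hf n).subset_closure hn)
  obtain ⟨I', hII', hTI'⟩ := hL.exists_augs hE hc hIb hT hTE
  have hI'b := hII'.isBase hIb
  obtain ⟨hfin1, hfin2⟩ := hII'.finite_sdiff
  have hspan : I \ I' ∪ T ⊆ N.closure I' := union_subset
    (sdiff_subset.trans ((N.subset_closure I (hE ▸ hIb.subset_ground)).trans
      hII'.closure_subset)) hTI'
  obtain ⟨G, hGI', hGfin, -, hG⟩ :=
    exists_subset_finite_closure_of_subset_closure (hfin2.union hT) hspan
  have hev : ∀ a ∈ (I' \ I) ∪ G, ∀ᶠ n in Filter.atTop, a ∈ Qs n := by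
    intro a ha
    obtain ⟨n, hn⟩ := hQ a (hI'b.subset_ground (ha.elim (fun h ↦ h.1) fun h ↦ hGI' h))
    filter_upwards [Filter.eventually_ge_atTop n] with m hm'
    exact hQm hm' hn
  -- The stage is late enough for `Qs n` to contain all added elements and the finite part of `I'`
  -- that spans `T` and the removed elements; hence `I' ∩ Qs n` spans `Is n` in `N`.
  obtain ⟨n, hn⟩ := ((Filter.eventually_all_finite (hfin1.union hGfin)).2 hev).exists
  have hGn : G ⊆ I' ∩ Qs n := fun a ha ↦ ⟨hGI' ha, hn a (.inr ha)⟩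
  have hcl : I \ I' ∪ T ⊆ N.closure (I' ∩ Qs n) := hG.trans (N.closure_subset_closure hGn)
  have hIn : Is n ⊆ N.closure (I' ∩ Qs n) := by
    intro a ha
    by_cases haI' : a ∈ I'
    · exact N.mem_closure_of_mem' ⟨haI', (hf n).subset ha⟩
        (hE ▸ (hf n).subset_ground ((hf n).subset ha))
    · exact hcl (.inl ⟨mem_iUnion.2 ⟨n, ha⟩, haI'⟩)
  refine ⟨Qs n, I' ∩ Qs n, ⟨inter_subset_right, (hf n).subset_ground,
    hI'b.indep.subset inter_subset_left, fun v hv ↦ ?_, ?_,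
    (hf n).loose.minor_mono (hf n).subset inter_subset_right hIn⟩, subset_union_right.trans hcl⟩
  · by_contra hcon
    have hvE := (hf n).subset_ground hv
    have hvI' : v ∉ I' := fun h ↦ hcon (M.mem_closure_of_mem' ⟨h, hv⟩ hvE)
    obtain ⟨C, hCI', hC, hvC⟩ :=
      (mem_closure_iff_exists_isCircuit hvI').1 (hI'b.closure_eq.symm ▸ hvE)
    obtain ⟨c, hcC, hcn⟩ : ∃ c ∈ C \ {v}, c ∉ Qs n := by
      by_contra! h
      have hsub : C \ {v} ⊆ I' ∩ Qs n := fun a ha ↦ ⟨(hCI' ha.1).resolve_left ha.2, h a ha⟩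
      exact hcon (M.closure_subset_closure hsub (hC.mem_closure_sdiff_singleton_of_mem hvC))
    have hsub : ∀ a ∈ C, a ∉ Qs n → a ∈ I := by
      intro a haC han
      obtain rfl | haI' := hCI' haC
      · exact (han hv).elim
      by_contra haI
      exact han (hn a (.inl ⟨haI', haI⟩))
    -- Replacing the elements of `C` in `Qs n` by `Is n`, which spans them in `M`, exhibits `c` as
    -- spanned by the rest of the independent set `I`.
    refine hi.notMem_closure_sdiff_of_mem (hsub c hcC.1 hcn)
      (closure_subset_closure_of_subset_closure ?_ (hC.mem_closure_sdiff_singleton_of_mem hcC.1))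
    rintro a ⟨haC, hac⟩
    by_cases han : a ∈ Qs n
    · refine M.closure_subset_closure (subset_sdiff_singleton (subset_iUnion _ n) ?_)
        ((hf n).subset_closure han)
      exact fun h ↦ hcn ((hf n).subset h)
    · exact M.mem_closure_of_mem' ⟨hsub a haC han, hac⟩ (hC.subset_ground haC)
  · refine (hf n).subset_closure_right.trans (closure_subset_closure_of_subset_closure ?_)
    refine union_subset (hIn.trans (N.closure_subset_closure subset_union_left)) ?_
    exact N.subset_closure_of_subset' subset_union_right sdiff_subset

/-- For a countable loose pair of finitary matroids there is an independent set of the first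
matroid that is spanning in the second one. -/
theorem Loose.exists_indep_spanning [M.Finitary] [N.Finitary] (hL : Loose M N) (hE : M.E = N.E)
    (hc : M.E.Countable) : ∃ I, M.Indep I ∧ N.E ⊆ N.closure I := by
  obtain ⟨Qs, Is, hQm, hIm, hf, hQ⟩ := hL.exists_chain hc (fun e _ I ↦ e ∈ N.closure I) (by
    intro Q I e h he
    have heQ : e ∈ N.closure (I ∪ (N.E \ Q)) := by
      by_cases heQ : e ∈ Q
      · exact h.subset_closure_right heQ
      · exact N.mem_closure_of_mem' (.inr ⟨hE ▸ he, heQ⟩) (hE ▸ he)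
    -- Only the finite part of `F` outside `Q` still has to be spanned; it is handed to the loose
    -- residual pair.
    obtain ⟨F, hFsub, hFfin, -, hF⟩ := exists_mem_finite_closure_of_mem_closure heQ
    have hTsub : F ∩ (N.E \ Q) ⊆ (M ／ Q).E := by
      rw [contract_ground, hE]
      exact inter_subset_right
    obtain ⟨Q', I', h', hT⟩ := h.loose.exists_isFeasible_closure
      (by rw [contract_ground, ground_contract_delete_eq N h.subset, hE])
      (hc.mono (contract_ground_subset_ground M Q)) (hFfin.subset inter_subset_left) hTsub
    have hu := h.union hE h'
    refine ⟨_, _, hu, subset_union_left, subset_union_left,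
      closure_subset_closure_of_subset_closure (fun a ha ↦ ?_) hF⟩
    have hdj : Disjoint I' Q := (subset_sdiff.1 (h'.subset.trans h'.subset_ground)).2
    rw [closure_contract_delete_eq N h.subset hdj] at hT
    obtain haI | ha' := hFsub ha
    · exact N.mem_closure_of_mem' (.inl haI) (hE ▸ h.subset_ground (h.subset haI))
    · exact (hT ⟨ha, ha'⟩).1)
  refine ⟨⋃ n, Is n, indep_iUnion_of_monotone hIm fun n ↦ (hf n).indep, fun e he ↦ ?_⟩
  obtain ⟨n, hn⟩ := hQ e (hE ▸ he)
  exact N.closure_subset_closure (subset_iUnion _ n) hn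

/-- No `N`-circuit inside `S ∪ (N.E \ W)` meets `S`, so `S` does not help to span anything outside
`W`. -/
lemma IsWave.mem_closure_of_mem_closure_union (hW : IsWave M N W S) (hX : X ⊆ N.E \ W)
    (he : e ∈ N.E \ W) (h : e ∈ N.closure (S ∪ X)) : e ∈ N.closure X := by
  by_cases heX : e ∈ X
  · exact N.mem_closure_of_mem' heX he.1
  have heS : e ∉ S ∪ X := fun h ↦ h.elim (fun h ↦ he.2 (hW.subset h)) heX
  obtain ⟨C, hCS, hC, heC⟩ := (mem_closure_iff_exists_isCircuit heS).1 h
  have hCS' : ∀ s ∈ C, s ∉ S := by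
    refine fun s hsC hsS ↦ hW.notMem_closure s hsS ?_
    refine N.closure_subset_closure ?_ (hC.mem_closure_sdiff_singleton_of_mem hsC)
    rintro a ⟨haC, has⟩
    obtain rfl | haS | haX := hCS haC
    · exact .inr he
    · exact .inl ⟨haS, has⟩
    · exact .inr (hX haX)
  refine N.closure_subset_closure (fun a ha ↦ ?_) (hC.mem_closure_sdiff_singleton_of_mem heC)
  exact ((hCS ha.1).resolve_left ha.2).resolve_left (hCS' a ha.1)

/-- Nash-Williams' matroid intersection conjecture for countable finitary matroids. -/
theorem exists_indep_indep_subset_closure [M.Finitary] [N.Finitary] (hE : M.E = N.E)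
    (hc : M.E.Countable) : ∃ P B, P ⊆ M.E ∧ M.Indep B ∧ N.Indep B ∧ P ⊆ M.closure (B ∩ P) ∧
      N.E \ P ⊆ N.closure (B \ P) := by
  obtain ⟨W, S, hW, hS, hL⟩ := exists_isWave_loose M N
  obtain ⟨I, hI, hIN⟩ := hL.exists_indep_spanning
    (by rw [contract_ground, ground_contract_delete_eq N hW.subset, hE])
    (hc.mono (contract_ground_subset_ground M W))
  have hb : M.IsBasis S W := hS.isBasis_of_subset_of_subset_closure hW.subset hW.subset_closure
  obtain ⟨hSI, hdj⟩ := hb.contract_indep_iff.1 hI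
  rw [closure_contract_delete_eq N hW.subset hdj.symm, ground_contract_delete_eq N hW.subset] at hIN
  have hIE : I ⊆ N.E \ W :=
    subset_sdiff.2 ⟨hE ▸ subset_union_left.trans hSI.subset_ground, hdj.symm⟩
  obtain ⟨J, hJ⟩ := N.exists_isBasis I (hIE.trans sdiff_subset)
  have hJE := hJ.subset.trans hIE
  have hJcl : N.E \ W ⊆ N.closure J := by
    intro e he
    rw [hJ.closure_eq_closure]
    exact hW.mem_closure_of_mem_closure_union hIE he (hIN he).1
  have hJW : Disjoint J W := (subset_sdiff.1 hJE).2
  refine ⟨W, S ∪ J, hW.subset_ground, ?_, ?_, ?_, ?_⟩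
  · rw [union_comm]
    exact hSI.subset (union_subset_union_left _ hJ.subset)
  · refine (indep_iff_forall_notMem_closure_sdiff (union_subset
      (hE ▸ hS.subset_ground) (hJE.trans sdiff_subset))).2 ?_
    rintro e (he | he) hcl
    · refine hW.notMem_closure e he (N.closure_subset_closure ?_ hcl)
      rw [union_sdiff_distrib]
      exact union_subset_union_right _ (sdiff_subset.trans hJE)
    · refine hJ.indep.notMem_closure_sdiff_of_mem he
        (hW.mem_closure_of_mem_closure_union (sdiff_subset.trans hJE) (hJE he) ?_)
      refine N.closure_subset_closure ?_ hcl
      rw [union_sdiff_distrib]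
      exact union_subset_union_left _ sdiff_subset
  · rw [union_inter_distrib_right, inter_eq_self_of_subset_left hW.subset,
      hJW.inter_eq, union_empty]
    exact hW.subset_closure
  · rw [union_sdiff_distrib, sdiff_eq_empty.2 hW.subset, empty_union, hJW.sdiff_eq_left]
    exact hJcl

end Intersection

/-! ### Closure in sums and duals. -/

section Sum

variable {α ι : Type*}

lemma mem_closure_iff_of_isBasis' {M : Matroid α} {I X : Set α} {e : α} (hI : M.IsBasis' I X) :
    e ∈ M.closure X ↔ e ∈ M.E ∧ (M.Indep (insert e I) → e ∈ I) := by
  rw [← hI.closure_eq_closure, hI.indep.mem_closure_iff']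

lemma mem_closure_sum'_iff {M : ι → Matroid α} {X : Set (ι × α)} {i : ι} {e : α} :
    (i, e) ∈ (Matroid.sum' M).closure X ↔ e ∈ (M i).closure (Prod.mk i ⁻¹' X) := by
  rw [← closure_inter_ground, ← closure_inter_ground (M i)]
  obtain ⟨B, hB⟩ := (Matroid.sum' M).exists_isBasis (X ∩ (Matroid.sum' M).E) inter_subset_right
  have hBi := sum'_isBasis_iff.1 hB
  have hXi : Prod.mk i ⁻¹' (X ∩ (Matroid.sum' M).E) = Prod.mk i ⁻¹' X ∩ (M i).E := by
    ext a
    simp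
  rw [mem_closure_iff_of_isBasis' hB.isBasis', ← hXi, mem_closure_iff_of_isBasis' (hBi i).isBasis']
  have hins : Prod.mk i ⁻¹' insert (i, e) B = insert e (Prod.mk i ⁻¹' B) := by
    ext a
    simp
  have hiff : (Matroid.sum' M).Indep (insert (i, e) B) ↔
      (M i).Indep (insert e (Prod.mk i ⁻¹' B)) := by
    rw [sum'_indep_iff]
    refine ⟨fun h ↦ hins ▸ h i, fun h j ↦ ?_⟩
    obtain rfl | hne := eq_or_ne i j
    · rwa [hins]
    · convert! (hBi j).indep using 1
      ext a
      simp [hne.symm]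
  rw [hiff]
  simp

lemma closure_disjointSum_eq {M N : Matroid α} (h : Disjoint M.E N.E) (X : Set α) :
    (M.disjointSum N h).closure X = M.closure X ∪ N.closure X := by
  obtain ⟨B, hB⟩ := (M.disjointSum N h).exists_isBasis (X ∩ (M.disjointSum N h).E)
    inter_subset_right
  obtain ⟨hM, hN, hBX, -⟩ := disjointSum_isBasis_iff.1 hB
  have hXM : X ∩ (M.disjointSum N h).E ∩ M.E = X ∩ M.E := by
    rw [disjointSum_ground_eq]
    ext a
    simp +contextual
  have hXN : X ∩ (M.disjointSum N h).E ∩ N.E = X ∩ N.E := by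
    rw [disjointSum_ground_eq]
    ext a
    simp +contextual
  rw [hXM] at hM
  rw [hXN] at hN
  have hBE : B ⊆ M.E ∪ N.E := by
    rw [← disjointSum_ground_eq (h := h)]
    exact hB.indep.subset_ground
  ext e
  rw [mem_union, ← closure_inter_ground, mem_closure_iff_of_isBasis' hB.isBasis',
    ← M.closure_inter_ground, ← N.closure_inter_ground,
    mem_closure_iff_of_isBasis' hM.isBasis', mem_closure_iff_of_isBasis' hN.isBasis',
    disjointSum_ground_eq, disjointSum_indep_iff, mem_union]
  by_cases heM : e ∈ M.E
  · have heN : e ∉ N.E := h.notMem_of_mem_left heM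
    rw [insert_inter_of_mem heM, insert_inter_of_notMem heN, insert_subset_iff]
    have := hN.indep
    simp only [mem_inter_iff, mem_union]
    tauto
  · by_cases heN : e ∈ N.E
    · rw [insert_inter_of_mem heN, insert_inter_of_notMem heM, insert_subset_iff]
      have := hM.indep
      simp only [mem_inter_iff, mem_union]
      tauto
    · simp [heM, heN]

lemma finitary_disjointSum {M N : Matroid α} [M.Finitary] [N.Finitary] (h : Disjoint M.E N.E) :
    (M.disjointSum N h).Finitary := by
  refine ⟨fun I hI ↦ disjointSum_indep_iff.2 ⟨?_, ?_, fun e he ↦ ?_⟩⟩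
  · refine indep_of_forall_finite_subset_indep _ fun J hJ hJfin ↦ ?_
    have := (disjointSum_indep_iff.1 (hI J (hJ.trans inter_subset_left) hJfin)).1
    rwa [inter_eq_self_of_subset_left (hJ.trans inter_subset_right)] at this
  · refine indep_of_forall_finite_subset_indep _ fun J hJ hJfin ↦ ?_
    have := (disjointSum_indep_iff.1 (hI J (hJ.trans inter_subset_left) hJfin)).2.1
    rwa [inter_eq_self_of_subset_left (hJ.trans inter_subset_right)] at this
  · exact (disjointSum_indep_iff.1 (hI {e} (by simpa) (finite_singleton e))).2.2 rfl

lemma mem_closure_iff_notMem_dual_closure {M : Matroid α} {X : Set α} {e : α} (he : e ∈ M.E)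
    (heX : e ∉ X) : e ∈ M.closure X ↔ e ∉ M✶.closure (M.E \ insert e X) := by
  have hloop : e ∈ M✶.closure (M.E \ insert e X) ↔ (M ＼ (M.E \ insert e X)).IsColoop e := by
    rw [← dual_isLoop_iff_isColoop, dual_delete, contract_isLoop_iff_mem_closure]
    simp
  have hE : (M ＼ (M.E \ insert e X)).E \ {e} = X ∩ M.E := by
    ext a
    simp only [delete_ground, mem_sdiff, mem_insert_iff, mem_singleton_iff, mem_inter_iff]
    refine ⟨fun h ↦ ⟨?_, h.1.1⟩, fun h ↦ ⟨⟨h.2, fun h' ↦ h'.2 (.inr h.1)⟩, ?_⟩⟩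
    · by_contra ha
      exact h.1.2 ⟨h.1.1, fun h' ↦ h'.elim h.2 ha⟩
    · rintro rfl
      exact heX h.1
  rw [hloop, isColoop_iff_notMem_closure_compl (by simpa), hE, delete_closure_eq_of_disjoint]
  · simp
  · exact disjoint_left.2 fun a ha h ↦ h.2 (.inr ha.1)

end Sum

/-! ### From intersection to packing and covering. -/

section Transfer

variable {α Θ : Type*} {E E' Ep : Set α}

/-- Packing and covering for countably many matroids, where only a part `E'` of the common ground
set has to be packed or covered. -/
theorem exists_packing_covering_of_countable [Countable Θ] (hE : E.Countable) (hE' : E' ⊆ E)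
    (M : Θ → Matroid α) (hME : ∀ i, (M i).E = E) (hM : ∀ i, (M i).IsFinitarySumCofinitary) :
    ∃ Ep ⊆ E', (∃ S : Θ → Set α, (∀ i j, i ≠ j → Disjoint (S i) (S j)) ∧
        ∀ i, S i ⊆ Ep ∧ Ep ⊆ (M i).closure (S i)) ∧
      ∃ I : Θ → Set α, (⋃ i, I i) = E' \ Ep ∧ ∀ i, (M i ／ Ep).Indep (I i) := by
  choose F C hd hF hC hM using hM
  have hFC : ∀ i, (F i).E ∪ (C i).E = E := fun i ↦ by
    rw [← hME i, hM i, disjointSum_ground_eq]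
  have hCE : ∀ i, (C i).E ⊆ E := fun i ↦ hFC i ▸ subset_union_right
  have hMcl : ∀ i X, (M i).closure X = (F i).closure X ∪ (C i).closure X := fun i X ↦ by
    rw [hM i, closure_disjointSum_eq]
  have hd' : ∀ i, Disjoint (F i).E (freeOn (C i).E).E := fun i ↦ by
    rw [freeOn_ground]
    exact hd i
  -- Each pair `(i, e)` gets two copies, parallel or loops after pulling back `A`. Choosing `inl (i,
  -- e)` assigns `e` to `M i`; the `none` summand of `D` allows one such `i` per `e`, and only for
  -- `e ∈ E'`. Choosing `inr (i, e)` puts `e` into a set independent in the dual of `C i`; on `(C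
  -- i).E` the only constraint from `A` is that the two choices exclude each other.
  let A : Matroid (Θ × α) := Matroid.sum' fun i ↦ (F i).disjointSum (freeOn (C i).E) (hd' i)
  let D : Matroid (Option Θ × α) := Matroid.sum' fun k : Option Θ ↦
    k.elim (freeOn E' ↾ E) fun i ↦ (C i)✶ ↾ E
  let φ : (Θ × α) ⊕ (Θ × α) → Θ × α := Sum.elim id id
  let ψ : (Θ × α) ⊕ (Θ × α) → Option Θ × α :=
    Sum.elim (fun p ↦ (none, p.2)) (fun p ↦ (some p.1, p.2))
  have : A.Finitary := Finitary.sum' fun i ↦ by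
    have := hF i
    exact finitary_disjointSum (hd' i)
  have : D.Finitary := Finitary.sum' fun k ↦ by
    cases k with
    | none => exact inferInstanceAs (freeOn E' ↾ E).Finitary
    | some i =>
      have : (C i)✶.Finitary := hC i
      exact inferInstanceAs ((C i)✶ ↾ E).Finitary
  have hAE : ∀ i e, (i, e) ∈ A.E ↔ e ∈ E := fun i e ↦ by
    simp [A, ← hFC i]
  have hDE : ∀ k e, (k, e) ∈ D.E ↔ e ∈ E := fun k e ↦ by
    cases k <;> simp [D]
  have hMN : (A.comap φ).E = (D.comap ψ).E := by
    ext (⟨i, e⟩ | ⟨i, e⟩) <;> simp [φ, ψ, hAE, hDE]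
  have hcount : (A.comap φ).E.Countable := by
    have hprod : (univ ×ˢ E : Set (Θ × α)).Countable := countable_univ.prod hE
    refine ((hprod.image Sum.inl).union (hprod.image Sum.inr)).mono ?_
    rintro (⟨i, e⟩ | ⟨i, e⟩) h <;> simpa [φ, hAE] using h
  obtain ⟨P, B, hPE, hBM, hBN, hPcl, hNcl⟩ :=
    exists_indep_indep_subset_closure (M := A.comap φ) (N := D.comap ψ) hMN hcount
  let P₁ : Θ → Set α := fun i ↦ {e | Sum.inl (i, e) ∈ P}
  let P₂ : Θ → Set α := fun i ↦ {e | Sum.inr (i, e) ∈ P}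
  let B₁ : Θ → Set α := fun i ↦ {e | Sum.inl (i, e) ∈ B}
  let B₂ : Θ → Set α := fun i ↦ {e | Sum.inr (i, e) ∈ B}
  rw [comap_indep_iff] at hBM hBN
  rw [comap_closure_eq] at hPcl hNcl
  have hφ : ∀ i (X : Set ((Θ × α) ⊕ (Θ × α))),
      Prod.mk i ⁻¹' (φ '' X) = {e | Sum.inl (i, e) ∈ X ∨ Sum.inr (i, e) ∈ X} := by
    intro i X
    ext e
    simp [φ]
  have hψ : ∀ i (X : Set ((Θ × α) ⊕ (Θ × α))),
      Prod.mk (some i) ⁻¹' (ψ '' X) = {e | Sum.inr (i, e) ∈ X} := by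
    intro i X
    ext e
    simp [ψ]
  have hψ₀ : ∀ (X : Set ((Θ × α) ⊕ (Θ × α))),
      Prod.mk none ⁻¹' (ψ '' X) = {e | ∃ i, Sum.inl (i, e) ∈ X} := by
    intro X
    ext e
    simp [ψ]
  have hdisj : ∀ i e, e ∈ B₁ i → e ∉ B₂ i := fun i e h₁ h₂ ↦ by
    simpa using hBM.2 h₁ h₂ rfl
  have hB₁eq : ∀ i j e, e ∈ B₁ i → e ∈ B₁ j → i = j := fun i j e hi hj ↦ by
    simpa using hBN.2 hi hj rfl
  have hB₂i : ∀ i, (C i)✶.Indep (B₂ i) := fun i ↦ by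
    have := sum'_indep_iff.1 hBN.1 (some i)
    rw [hψ] at this
    exact (restrict_indep_iff.1 this).1
  have hB₂C : ∀ i, B₂ i ⊆ (C i).E := fun i ↦ (hB₂i i).subset_ground
  have hB₁E : ∀ i, B₁ i ⊆ E' := fun i e he ↦ by
    have := sum'_indep_iff.1 hBN.1 none
    rw [hψ₀] at this
    exact (freeOn_indep_iff.1 (restrict_indep_iff.1 this).1) ⟨i, he⟩
  have hB₁F : ∀ i, (F i).Indep (B₁ i ∩ (F i).E) := fun i ↦ by
    have := sum'_indep_iff.1 hBM.1 i
    rw [hφ] at this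
    refine (disjointSum_indep_iff.1 this).1.subset (inter_subset_inter_left _ fun e he ↦ .inl he)
  have hPF : ∀ i e, e ∈ P₁ i → e ∈ (F i).E → e ∈ (F i).closure (B₁ i ∩ P₁ i) := by
    intro i e he heF
    have : (i, e) ∈ A.closure (φ '' (B ∩ P)) := hPcl he
    have := mem_closure_sum'_iff.1 this
    rw [hφ, closure_disjointSum_eq, freeOn_closure_eq] at this
    have := this.resolve_right fun h ↦ (hd i).notMem_of_mem_left heF h.2
    rw [← closure_inter_ground] at this
    refine (F i).closure_subset_closure (fun a ha ↦ ?_) this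
    obtain ⟨ha | ha, haF⟩ := ha
    · exact ha
    · exact ((hd i).notMem_of_mem_left haF (hB₂C i ha.1)).elim
  have hPC : ∀ i e, e ∈ P₁ i ∪ P₂ i → e ∈ (C i).E → e ∈ B₁ i ∩ P₁ i ∪ B₂ i ∩ P₂ i := by
    intro i e he heC
    have : (i, e) ∈ A.closure (φ '' (B ∩ P)) := he.elim (fun h ↦ hPcl h) fun h ↦ hPcl h
    have := mem_closure_sum'_iff.1 this
    rw [hφ, closure_disjointSum_eq, freeOn_closure_eq] at this
    exact (this.resolve_left fun h ↦
      (hd i).notMem_of_mem_right heC ((F i).closure_subset_ground _ h)).1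
  have hcov : ∀ k e, e ∈ E' → e ∉ P₁ k → ∃ l, e ∈ B₁ l ∧ e ∉ P₁ l := by
    intro k e he hek
    have : (none, e) ∈ D.closure (ψ '' (B \ P)) :=
      hNcl (a := Sum.inl (k, e)) ⟨by simpa [ψ, hDE] using hE' he, hek⟩
    have := mem_closure_sum'_iff.1 this
    rw [hψ₀, Option.elim_none, restrict_closure_eq', freeOn_closure_eq] at this
    obtain ⟨⟨⟨l, hl⟩, -⟩, -⟩ := (this.resolve_right fun h ↦ h.2 he).1
    exact ⟨l, hl⟩
  have hB₂cl : ∀ i e, e ∈ (C i).E → e ∉ P₂ i → e ∈ (C i)✶.closure (B₂ i \ P₂ i) := by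
    intro i e heC heP
    have : (some i, e) ∈ D.closure (ψ '' (B \ P)) :=
      hNcl (a := Sum.inr (i, e)) ⟨by simpa [ψ, hDE] using hCE i heC, heP⟩
    have := mem_closure_sum'_iff.1 this
    rw [hψ, Option.elim_some, restrict_closure_eq'] at this
    exact (C i)✶.closure_subset_closure inter_subset_left
      (this.resolve_right fun h ↦ h.2 heC).1
  -- The copies `inl (i, e)` of one `e` are indistinguishable in `D`: if one lies outside `P`, then
  -- `e` is chosen by a copy outside `P`, and by no other `inl` copy.
  let Ep : Set α := {e | e ∈ E' ∧ ∀ i, e ∈ P₁ i}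
  have hBP : ∀ i e, e ∈ B₁ i → e ∈ P₁ i → e ∈ Ep := by
    refine fun i e heB heP ↦ ⟨hB₁E i heB, fun k ↦ ?_⟩
    by_contra hk
    obtain ⟨l, hl, hlP⟩ := hcov k e (hB₁E i heB) hk
    obtain rfl := hB₁eq _ _ e heB hl
    exact hlP heP
  have hEpE' : Ep ⊆ E' := fun e he ↦ he.1
  refine ⟨Ep, hEpE', ⟨fun i ↦ B₁ i ∩ Ep, fun i j hij ↦ disjoint_left.2 fun e hi hj ↦
    hij (hB₁eq i j e hi.1 hj.1), fun i ↦ ⟨inter_subset_right, fun e he ↦ ?_⟩⟩,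
    fun i ↦ (B₁ i) \ Ep, ?_, fun i ↦ ?_⟩
  · rw [hMcl]
    obtain heF | heC : e ∈ (F i).E ∪ (C i).E := hFC i ▸ hE' he.1
    · have hsub : B₁ i ∩ P₁ i ⊆ B₁ i ∩ Ep := fun a ha ↦ ⟨ha.1, hBP i a ha.1 ha.2⟩
      exact .inl ((F i).closure_subset_closure hsub (hPF i e (he.2 i) heF))
    · right
      obtain heB | heB := hPC i e (.inl (he.2 i)) heC
      · exact (C i).mem_closure_of_mem' ⟨heB.1, he⟩ heC
      by_cases heB' : e ∈ B₁ i
      · exact (C i).mem_closure_of_mem' ⟨heB', he⟩ heC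
      -- Otherwise the complement would span `e` in the dual. Each of its elements is spanned there
      -- by `B₂ i \ {e}`, contradicting independence of `B₂ i`.
      rw [mem_closure_iff_notMem_dual_closure heC fun h ↦ heB' h.1]
      intro hcl
      refine (hB₂i i).notMem_closure_sdiff_of_mem heB.1
        (closure_subset_closure_of_subset_closure ?_ hcl)
      rintro a ⟨haC, ha⟩
      by_cases haP : a ∈ P₂ i
      · obtain h | h := hPC i a (.inr haP) haC
        · exact (ha (.inr ⟨h.1, hBP i a h.1 h.2⟩)).elim
        · exact (C i)✶.mem_closure_of_mem' ⟨h.1, fun h ↦ ha (.inl h)⟩ haC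
      · refine (C i)✶.closure_subset_closure ?_ (hB₂cl i a haC haP)
        exact fun b hb ↦ ⟨hb.1, fun h ↦ hb.2 (h ▸ heB.2)⟩
  · ext e
    simp only [mem_iUnion, mem_sdiff]
    refine ⟨fun ⟨i, hi, he⟩ ↦ ⟨hB₁E i hi, he⟩, fun ⟨he, heE⟩ ↦ ?_⟩
    obtain ⟨k, hk⟩ : ∃ k, e ∉ P₁ k := by
      by_contra! h
      exact heE ⟨he, h⟩
    obtain ⟨l, hl, -⟩ := hcov k e he hk
    exact ⟨l, hl, heE⟩
  · have hsub : B₁ i \ Ep ⊆ (M i ／ Ep).E := by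
      rw [contract_ground, hME i]
      exact sdiff_subset_sdiff_left ((hB₁E i).trans hE')
    refine (indep_iff_forall_notMem_closure_sdiff hsub).2 fun e he hcl ↦ ?_
    rw [contract_closure_eq, hMcl] at hcl
    have heP : e ∉ P₁ i := fun h ↦ he.2 (hBP i e he.1 h)
    obtain heF | heC := hcl.1
    · have heFE := (F i).closure_subset_ground _ heF
      refine (hB₁F i).notMem_closure_sdiff_of_mem ⟨he.1, heFE⟩ ?_
      rw [← closure_inter_ground] at heF
      refine closure_subset_closure_of_subset_closure ?_ heF
      rintro a ⟨⟨⟨haB, -⟩, hae⟩ | ha, haF⟩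
      · exact (F i).mem_closure_of_mem' ⟨⟨haB, haF⟩, hae⟩ haF
      · have := hPF i a (ha.2 i) haF
        rw [← closure_inter_ground] at this
        have hsub : B₁ i ∩ P₁ i ∩ (F i).E ⊆ (B₁ i ∩ (F i).E) \ {e} := fun b hb ↦
          ⟨⟨hb.1.1, hb.2⟩, fun h ↦ heP (h ▸ hb.1.2)⟩
        exact (F i).closure_subset_closure hsub this
    · have heCE := (C i).closure_subset_ground _ heC
      rw [mem_closure_iff_notMem_dual_closure heCE
        (by rintro (h | h); exacts [h.2 rfl, he.2 h])] at heC
      apply heC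
      -- The second copy of `e` lies outside `P`, so `B₂ i \ P₂ i` spans `e` in the dual; that set
      -- avoids both `B₁ i` and `Ep`.
      by_cases heP₂ : e ∈ P₂ i
      · obtain h | h := hPC i e (.inr heP₂) heCE
        · exact (heP h.2).elim
        · exact (hdisj i e he.1 h.1).elim
      · refine (C i)✶.closure_subset_closure ?_ (hB₂cl i e heCE heP₂)
        rintro a ⟨haB, haP⟩
        have haC := hB₂C i haB
        have haB₁ : a ∉ B₁ i := fun h ↦ hdisj i a h haB
        refine ⟨haC, ?_⟩
        rintro (rfl | ⟨⟨h, -⟩, -⟩ | h)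
        · exact haB₁ he.1
        · exact haB₁ h
        · obtain h' | h' := hPC i a (.inl (h.2 i)) haC
          · exact haB₁ h'.1
          · exact haP h'.2

end Transfer

/-! ### Arbitrary index sets. -/

/-- Sequences of infinite sets have injective choice functions. -/
lemma exists_injective_forall_mem_of_nat {Θ : Type*} {A : ℕ → Set Θ}
    (hA : ∀ n, (A n).Infinite) : ∃ g : ℕ → Θ, Function.Injective g ∧ ∀ n, g n ∈ A n := by
  classical
  choose p hpA hp using fun n (s : Finset Θ) ↦ (hA n).exists_notMem_finset s
  let hist : ℕ → Finset Θ := fun n ↦ Nat.rec ∅ (fun n s ↦ insert (p n s) s) n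
  have hsucc : ∀ n, hist (n + 1) = insert (p n (hist n)) (hist n) := fun n ↦ rfl
  have hmono : Monotone hist := monotone_nat_of_le_succ fun n ↦ by
    rw [hsucc]
    exact Finset.subset_insert _ _
  have hne : ∀ m n, m < n → p m (hist m) ≠ p n (hist n) := fun m n hmn h ↦ by
    refine hp n (hist n) (h ▸ hmono (Nat.succ_le_of_lt hmn) ?_)
    rw [Nat.succ_eq_add_one, hsucc]
    exact Finset.mem_insert_self _ _
  refine ⟨fun n ↦ p n (hist n), fun m n h ↦ ?_, fun n ↦ hpA n _⟩
  by_contra hmn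
  obtain hlt | hlt := Nat.lt_or_gt_of_ne hmn
  · exact hne m n hlt h
  · exact hne n m hlt h.symm

/-- Countable families of infinite sets have injective choice functions. -/
lemma exists_injective_forall_mem {ι Θ : Type*} [Countable ι] {A : ι → Set Θ}
    (hA : ∀ k, (A k).Infinite) : ∃ g : ι → Θ, Function.Injective g ∧ ∀ k, g k ∈ A k := by
  obtain h | h := isEmpty_or_nonempty ι
  · exact ⟨isEmptyElim, fun k ↦ isEmptyElim k, fun k ↦ isEmptyElim k⟩
  obtain ⟨f, hf⟩ := exists_surjective_nat ι
  obtain ⟨g, hginj, hg⟩ := exists_injective_forall_mem_of_nat fun n ↦ hA (f n)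
  choose k hk using hf
  refine ⟨fun e ↦ g (k e), fun a b hab ↦ ?_, fun e ↦ ?_⟩
  · rw [← hk a, ← hk b, hginj hab]
  · simpa [hk] using hg (k e)

/-- Packing and covering for an arbitrary family: all but countably many of the matroids have only
loops outside the set `Z` of elements that are nonloops of uncountably many of them. -/
theorem exists_packing_covering {α Θ : Type*} {E : Set α} (hE : E.Countable) (M : Θ → Matroid α)
    (hME : ∀ i, (M i).E = E) (hM : ∀ i, (M i).IsFinitarySumCofinitary) :
    ∃ Ep ⊆ E, (∃ S : Θ → Set α, (∀ i j, i ≠ j → Disjoint (S i) (S j)) ∧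
        ∀ i, S i ⊆ Ep ∧ Ep ⊆ (M i).closure (S i)) ∧
      ∃ I : Θ → Set α, (⋃ i, I i) = E \ Ep ∧ ∀ i, (M i ／ Ep).Indep (I i) := by
  classical
  let N : α → Set Θ := fun e ↦ {i | (M i).IsNonloop e}
  let E' : Set α := {e ∈ E | (N e).Countable}
  let Θ₁ : Set Θ := ⋃ e ∈ E', N e
  have hE'E : E' ⊆ E := sep_subset _ _
  have hΘ₁ : Θ₁.Countable := (hE.mono hE'E).biUnion fun e he ↦ he.2
  have : Countable Θ₁ := hΘ₁.to_subtype
  obtain ⟨Ep, hEp, ⟨S, hSd, hS⟩, I, hIE, hI⟩ := exists_packing_covering_of_countable hE hE'E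
    (fun i : Θ₁ ↦ M i) (fun i ↦ hME i) fun i ↦ hM i
  have hloop : ∀ i ∉ Θ₁, Ep ⊆ (M i).closure ∅ := by
    intro i hi e he
    by_contra hcl
    have heE : e ∈ (M i).E := hME i ▸ hE'E (hEp he)
    exact hi (mem_biUnion (hEp he) ((isNonloop_iff_notMem_loops heE).2 hcl))
  -- An uncountable set minus a countable one. Hence distinct elements `z` receive distinct matroids
  -- outside `Θ₁`, where `Ep` consists of loops and `{z}` stays independent after contraction.
  have hinf : ∀ z : (E \ E' : Set α), (N z \ Θ₁).Infinite := fun z hfin ↦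
    z.2.2 ⟨z.2.1, (hfin.countable.union hΘ₁).mono fun i hi ↦ by
      by_cases h : i ∈ Θ₁
      exacts [.inr h, .inl ⟨hi, h⟩]⟩
  have : Countable (E \ E' : Set α) := (hE.mono sdiff_subset).to_subtype
  obtain ⟨g, hginj, hg⟩ := exists_injective_forall_mem hinf
  refine ⟨Ep, hEp.trans hE'E, ⟨fun i ↦ if h : i ∈ Θ₁ then S ⟨i, h⟩ else ∅, fun i j hij ↦ ?_,
    fun i ↦ ?_⟩, fun i ↦ if h : i ∈ Θ₁ then I ⟨i, h⟩ else (↑) '' (g ⁻¹' {i}), ?_, fun i ↦ ?_⟩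
  · by_cases hi : i ∈ Θ₁
    · by_cases hj : j ∈ Θ₁
      · simpa [hi, hj] using hSd ⟨i, hi⟩ ⟨j, hj⟩ (by simpa)
      · simp [hj]
    · simp [hi]
  · by_cases hi : i ∈ Θ₁
    · simpa [hi] using hS ⟨i, hi⟩
    · simpa [hi] using hloop i hi
  · refine subset_antisymm (iUnion_subset fun i e he ↦ ?_) fun e he ↦ ?_
    · by_cases hi : i ∈ Θ₁
      · rw [dif_pos hi] at he
        have : e ∈ E' \ Ep := hIE ▸ mem_iUnion_of_mem _ he
        exact ⟨hE'E this.1, this.2⟩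
      · rw [dif_neg hi] at he
        obtain ⟨z, -, rfl⟩ := he
        exact ⟨z.2.1, fun h ↦ z.2.2 (hEp h)⟩
    · by_cases heE' : e ∈ E'
      · have : e ∈ ⋃ i, I i := hIE ▸ ⟨heE', he.2⟩
        obtain ⟨i, hi⟩ := mem_iUnion.1 this
        exact mem_iUnion.2 ⟨i, by simpa using hi⟩
      · refine mem_iUnion.2 ⟨g ⟨e, he.1, heE'⟩, ?_⟩
        rw [dif_neg (hg _).2]
        exact ⟨_, rfl, rfl⟩
  · by_cases hi : i ∈ Θ₁
    · simpa [hi] using hI ⟨i, hi⟩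
    · simp only [hi, dite_false]
      have hsub : (g ⁻¹' {i}).Subsingleton := subsingleton_singleton.preimage hginj
      obtain h | ⟨z, h⟩ := hsub.eq_empty_or_singleton
      · simp [h]
      · obtain rfl : g z = i := (h ▸ mem_singleton z : z ∈ g ⁻¹' {i})
        rw [h, image_singleton, indep_singleton, contract_isNonloop_iff]
        have hnl : (M (g z)).IsNonloop z := (hg z).1
        refine ⟨hnl.mem_ground, fun hcl ↦ (isNonloop_iff_notMem_loops hnl.mem_ground).1 hnl ?_⟩
        exact closure_subset_closure_of_subset_closure (hloop _ hi) hcl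

end Matroid

theorem theorem1p1 {α Θ : Type*} (E : Set α) (hE : E.Countable) (M : Θ → Matroid α)
    (hME : ∀ i, (M i).E = E) (hM : ∀ i, (M i).IsFinitarySumCofinitary) :
    ∃ Ep Ec : Set α, Ep ∪ Ec = E ∧ Disjoint Ep Ec ∧
      (∃ S : Θ → Set α, Matroid.IsPacking (fun i => (M i).restrict Ep) S) ∧
      (∃ I : Θ → Set α, Matroid.IsCovering Ec (fun i => (M i).contractOnto Ec) I) := by
  obtain ⟨Ep, hEp, ⟨S, hSd, hS⟩, I, hIE, hI⟩ := Matroid.exists_packing_covering hE M hME hM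
  refine ⟨Ep, E \ Ep, Set.union_sdiff_cancel hEp, Set.disjoint_sdiff_right, ⟨S, hSd, fun i ↦ ?_⟩,
    I, hIE, fun i ↦ ?_⟩
  · exact (Matroid.restrict_spanning_iff (hS i).1 (hME i ▸ hEp)).2 (hS i).2
  · have hE : (M i).E \ (E \ Ep) = Ep := by rw [hME i, Set.sdiff_sdiff_cancel_left hEp]
    change ((M i).contract ((M i).E \ (E \ Ep))).Indep (I i)
    rw [hE]
    exact hI i
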